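/- Let $\mathbb{N}^*=\{1,2,3,\dots\}$. For an infinite word $w$ on an arbitrary (finite or infinite) alphabet, let $n_1=0<n_2<n_3<\cdots$ be the lengths of its palindromic prefixes (the empty prefix included). Put $\delta(w)=\limsup_{i\to\infty} n_{i+1}/n_i\in[1,+\infty]$ if there are infinitely many palindromic prefixes, and $\delta(w)=+\infty$ otherwise. The word $w$ has abundant palindromic prefixes if it has infinitely many palindromic prefixes and $n_{i+1}\le 2n_i+1$ for all $i\ge 1$. Let $\mathcal{D}$ be the set of all values $\delta(w)$, for infinite words $w$ on arbitrary alphabets, and let $\mathcal{D}_0$ be the set of all values $\delta(w)$ for words $w$ with abundant palindromic prefixes. Let $\mathcal{A}$ be a set (of letters) disjoint from $\mathbb{N}^*$, and consider functions $\psi:\mathbb{N}^*\to\mathbb{N}^*\sqcup\mathcal{A}$ such that, for each $n\ge 1$, either $\psi(n)\in\mathcal{A}$ or $1\le\psi(n)\le n-1$. Let $t_0<t_1<\cdots$ be the (finite or infinite) family of all $n\ge1$ such that either $\psi(n)\in\mathcal{A}$ or $1\le\psi(n)\le n-2$. The function $\psi$ is called reduced if, for every $k\ge1$ such that $t_k$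 exists, $\psi(t_k)\ne\psi(t_{k-1})$, and either $\psi(t_k)\in\mathcal{A}$ or $\psi(t_k)<t_{k-1}$. For a reduced function $\psi$, define $\delta(\psi)=\limsup_{i\to\infty} n_{i+1}/n_i$, where the increasing sequence of non-negative integers $(n_i)_{i\ge1}$ is given by $n_1=0$ and, for all $i\ge 1$, $n_{i+1}=2n_i-n_{\psi(i)}$ if $\psi(i)\in\mathbb{N}^*$, and $n_{i+1}=2n_i+1$ if $\psi(i)\in\mathcal{A}$. Theorem. Both $\mathcal{D}_0$ and $\mathcal{D}\cap[1,2]$ are equal to the set of all values $\delta(\psi)$, where $\psi$ runs over all reduced functions (with $\mathcal{A}$ an arbitrary set). -/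

import Mathlib

open Filter
open scoped ENNReal

universe u

namespace PalPrefix

/-- `limsup n_{i+1} / n_i`, computed in `[0, ∞]`. -/
noncomputable def ratioLimsup (n : ℕ → ℕ) : ℝ≥0∞ :=
  limsup (fun i : ℕ => (n (i + 1) : ℝ≥0∞) / (n i : ℝ≥0∞)) atTop

section Words

variable {A : Type u}

/-- The prefix of length `n` of the infinite word `w = w 0, w 1, w 2, …`. -/
def wordPrefix (w : ℕ → A) (n : ℕ) : List A := (List.range n).map w

/-- The prefix of length `n` of `w` is a palindrome, i.e. it equals its mirror image. -/
def IsPalLength (w : ℕ → A) (n : ℕ) : Prop :=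
  (wordPrefix w n).reverse = wordPrefix w n

/-- `w` has infinitely many palindromic prefixes. -/
def InfinitelyManyPal (w : ℕ → A) : Prop := {n : ℕ | IsPalLength w n}.Infinite

/-- The increasing sequence `n_1 = 0 < n_2 < n_3 < …` of the lengths of the palindromic prefixes
of `w`. The index starts at `1`; the sequence is only used when there are infinitely many
palindromic prefixes. -/
noncomputable def palLength (w : ℕ → A) (i : ℕ) : ℕ := Nat.nth (IsPalLength w) (i - 1)

/-- `w` has abundant palindromic prefixes. -/
def HasAbundantPal (w : ℕ → A) : Prop :=
  InfinitelyManyPal w ∧ ∀ i : ℕ, 1 ≤ i → palLength w (i + 1) ≤ 2 * palLength w i + 1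

open Classical in
/-- `δ(w)`: the limsup of `n_{i+1} / n_i` if `w` has infinitely many palindromic prefixes, and `∞`
otherwise. -/
noncomputable def deltaWord (w : ℕ → A) : ℝ≥0∞ :=
  if InfinitelyManyPal w then ratioLimsup (palLength w) else ⊤

end Words

/-- The set `𝒟` of all values `δ(w)`, for infinite words `w` on arbitrary alphabets. -/
def setD : Set ℝ≥0∞ := {x | ∃ (A : Type u) (w : ℕ → A), deltaWord w = x}

/-- The set `𝒟₀` of all values `δ(w)`, for words `w` with abundant palindromic prefixes. -/
def setD₀ : Set ℝ≥0∞ :=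
  {x | ∃ (A : Type u) (w : ℕ → A), HasAbundantPal w ∧ deltaWord w = x}

section Functions

variable {A : Type u}

/-- The functions `ψ : ℕ* → ℕ* ⊔ A` such that, for each `n ≥ 1`, either `ψ n` is a letter or
`1 ≤ ψ n ≤ n - 1`. A function on `{1, 2, 3, …}` is represented by one on `ℕ`, whose value at `0`
plays no role. -/
def IsDirective (ψ : ℕ → ℕ ⊕ A) : Prop :=
  ∀ n : ℕ, 1 ≤ n → ∀ m : ℕ, ψ n = Sum.inl m → 1 ≤ m ∧ m < n

/-- The indices `n ≥ 1` which make up the family `t_0 < t_1 < …`: those for which `ψ n` is a letter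
or `1 ≤ ψ n ≤ n - 2`. -/
def IsBreak (ψ : ℕ → ℕ ⊕ A) (n : ℕ) : Prop :=
  1 ≤ n ∧ ((∃ a : A, ψ n = Sum.inr a) ∨ ∃ m : ℕ, ψ n = Sum.inl m ∧ 1 ≤ m ∧ m + 2 ≤ n)

/-- `s = t_{k-1}` and `t = t_k` for some `k ≥ 1`: consecutive members of the (finite or infinite)
family `t_0 < t_1 < …`. -/
def ConsecutiveBreaks (ψ : ℕ → ℕ ⊕ A) (s t : ℕ) : Prop :=
  IsBreak ψ s ∧ IsBreak ψ t ∧ s < t ∧ ∀ r : ℕ, s < r → r < t → ¬ IsBreak ψ r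

/-- Reduced functions: for all `k ≥ 1` such that `t_k` exists, `ψ (t_k) ≠ ψ (t_{k-1})`, and either
`ψ (t_k)` is a letter or `ψ (t_k) < t_{k-1}`. -/
def IsReduced (ψ : ℕ → ℕ ⊕ A) : Prop :=
  IsDirective ψ ∧ ∀ s t : ℕ, ConsecutiveBreaks ψ s t →
    ψ t ≠ ψ s ∧ ((∃ a : A, ψ t = Sum.inr a) ∨ ∃ m : ℕ, ψ t = Sum.inl m ∧ m < s)

/-- The sequence `(n_i)_{i ≥ 1}` associated with `ψ`: `n_1 = 0`, and for `i ≥ 1`,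
`n_{i+1} = 2 n_i - n_{ψ i}` if `ψ i` is an integer and `n_{i+1} = 2 n_i + 1` if `ψ i` is a letter.
(The value at index `0` plays no role, nor does the test `m < i + 2`, which always succeeds
when `IsDirective ψ`.) The subtraction does not truncate, see `cast_recSeq_succ_of_inl`. -/
def recSeq (ψ : ℕ → ℕ ⊕ A) : ℕ → ℕ
  | 0 => 0
  | 1 => 0
  | i + 2 =>
    match ψ (i + 1) with
    | Sum.inl m => 2 * recSeq ψ (i + 1) - (if _h : m < i + 2 then recSeq ψ m else 0)
    | Sum.inr _ => 2 * recSeq ψ (i + 1) + 1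
  termination_by i => i

theorem recSeq_one (ψ : ℕ → ℕ ⊕ A) : recSeq ψ 1 = 0 := by
  rw [recSeq]

theorem recSeq_succ_of_inr (ψ : ℕ → ℕ ⊕ A) {i : ℕ} (hi : 1 ≤ i) {a : A} (h : ψ i = Sum.inr a) :
    recSeq ψ (i + 1) = 2 * recSeq ψ i + 1 := by
  obtain ⟨j, rfl⟩ : ∃ j, i = j + 1 := ⟨i - 1, by omega⟩
  rw [recSeq, h]

theorem recSeq_succ_of_inl (ψ : ℕ → ℕ ⊕ A) (hψ : IsDirective ψ) {i : ℕ} (hi : 1 ≤ i) {m : ℕ}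
    (h : ψ i = Sum.inl m) : recSeq ψ (i + 1) = 2 * recSeq ψ i - recSeq ψ m := by
  have hm := (hψ i hi m h).2
  obtain ⟨j, rfl⟩ : ∃ j, i = j + 1 := ⟨i - 1, by omega⟩
  rw [recSeq, h]
  simp only
  rw [dif_pos (by omega)]

theorem recSeq_lt_of_lt (ψ : ℕ → ℕ ⊕ A) (hψ : IsDirective ψ) (i : ℕ) :
    ∀ j : ℕ, 1 ≤ j → j < i → recSeq ψ j < recSeq ψ i := by
  induction i with
  | zero => intro j _ h; omega
  | succ i ih =>
    intro j hj hji
    have hi : 1 ≤ i := by omega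
    have key : recSeq ψ i < recSeq ψ (i + 1) := by
      rcases h : ψ i with m | a
      · have hm := hψ i hi m h
        have := ih m hm.1 hm.2
        rw [recSeq_succ_of_inl ψ hψ hi h]
        omega
      · rw [recSeq_succ_of_inr ψ hi h]
        omega
    rcases Nat.lt_succ_iff_lt_or_eq.mp hji with h | h
    · exact (ih j hj h).trans key
    · rw [h]; exact key

theorem cast_recSeq_succ_of_inl (ψ : ℕ → ℕ ⊕ A) (hψ : IsDirective ψ) {i : ℕ} (hi : 1 ≤ i) {m : ℕ}
    (h : ψ i = Sum.inl m) : (recSeq ψ (i + 1) : ℤ) = 2 * recSeq ψ i - recSeq ψ m := by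
  have hm := hψ i hi m h
  have := recSeq_lt_of_lt ψ hψ i m hm.1 hm.2
  have h' := recSeq_succ_of_inl ψ hψ hi h
  omega

/-- `δ(ψ)`: the limsup of `n_{i+1} / n_i` for the sequence associated with `ψ`. -/
noncomputable def deltaFun (ψ : ℕ → ℕ ⊕ A) : ℝ≥0∞ := ratioLimsup (recSeq ψ)

end Functions

/-- The set of all values `δ(ψ)`, for reduced functions `ψ` with letters in arbitrary alphabets. -/
def reducedValues : Set ℝ≥0∞ :=
  {x | ∃ (A : Type u) (ψ : ℕ → ℕ ⊕ A), IsReduced ψ ∧ deltaFun ψ = x}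

end PalPrefix

/-! Let n_i < n_{i+1} be lengths of consecutive palindromic prefixes. If n_{i+1} ≤ 2n_i, the shorter
one occurs as prefix and as suffix of the longer, and these occurrences overlap in a palindromic
prefix of some length n_j, so n_{i+1} = 2n_i - n_j; if n_{i+1} = 2n_i + 1, a single letter separates
them. Recording j or the letter gives ψ. Between breaks the n_i form an arithmetic progression with
some difference d. A failure of reducedness at a break t makes n_{t+1} - n_t a proper multiple of d
and propagates the period d, so that n_t + d would be a skipped palindromic prefix
(`IsPalEnum.not_dvd_step`). Conversely ψ dictates a word block by block, and the theorem of Fine and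
Wilf turns an unlisted palindromic prefix into a failure of reducedness (`not_pal_wordOf`). This
settles 𝒟₀.

For 𝒟 ∩ [1,2], the value 2 is explicit. If δ(w) < 2, the overlaps exist only from some index on;
they are kept from there on, with distinct letters before. The new sequence x obeys the same linear
recurrence as n with other initial data, so it suffices that x_i/n_i tends to some R > 0
(`ratioLimsup_eq_of_tendsto`). Since x_{i+1} - x_i = x_i - x_m is a sum of earlier increments, the
quotient of the increments of x and n at i is a weighted mean of the quotients at m, …, i-1, where
n_m ≥ (2-q)n_i for a fixed q < 2. A Harnack inequality (`harnack`) makes these quotients converge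
(`exists_tendsto_increment`), and Stolz–Cesàro passes to x_i/n_i. -/

namespace PalPrefix

/-! ### Periods, palindromes and the theorem of Fine and Wilf -/

section Periods

variable {A : Type u} {w : ℕ → A}

/-- The prefix of length `N` of `w` has period `p`. -/
def HasPer (w : ℕ → A) (N p : ℕ) : Prop := ∀ k, k + p < N → w (k + p) = w k

/-- The prefix of length `N` of `w` is a palindrome, in terms of positions. -/
def Pal (w : ℕ → A) (N : ℕ) : Prop := ∀ k l, k + l + 1 = N → w k = w l

theorem isPalLength_iff_pal {N : ℕ} : IsPalLength w N ↔ Pal w N := by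
  unfold IsPalLength wordPrefix Pal
  constructor
  · intro h k l hkl
    have h1 := congrArg (fun L => L[k]?) h
    simp only [← List.map_reverse] at h1
    simp only [List.getElem?_map] at h1
    rw [List.getElem?_reverse (by simp; omega)] at h1
    have e1 : N - 1 - k = l := by omega
    simp only [List.length_range, e1] at h1
    rw [List.getElem?_range (by omega), List.getElem?_range (by omega)] at h1
    simpa using h1.symm
  · intro h
    apply List.ext_getElem
    · simp
    · intro k h1 h2
      simp only [List.length_reverse, List.length_map, List.length_range] at h1
      simp only [List.getElem_reverse, List.getElem_map, List.getElem_range, List.length_map,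
        List.length_range]
      exact h _ _ (by omega)

theorem pal_zero : Pal w 0 := fun _ _ h => by omega

theorem HasPer.mono {N M p : ℕ} (h : HasPer w N p) (hM : M ≤ N) : HasPer w M p :=
  fun k hk => h k (by omega)

theorem hasPer_of_pal {M p : ℕ} (h : Pal w (M + p)) (h' : Pal w M) : HasPer w (M + p) p := by
  intro k hk
  rw [h (k + p) (M - 1 - k) (by omega), h' (M - 1 - k) k (by omega)]

theorem Pal.extend {N p : ℕ} (h : Pal w N) (hp : HasPer w (N + p) p) (hpN : p ≤ N + 1) :
    Pal w (N + p) := by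
  have key : ∀ k l, k + l + 1 = N + p → k < N → w k = w l := by
    intro k l hkl hk
    rw [h k (N - 1 - k) (by omega), ← hp (N - 1 - k) (by omega)]
    congr 1
    omega
  intro k l hkl
  by_cases hk : k < N
  · exact key k l hkl hk
  by_cases hl : l < N
  · exact (key l k (by omega) hl).symm
  -- Both positions are at least `N`; as `p ≤ N + 1`, both equal `N`, the middle letter.
  · rw [show k = l by omega]

theorem Pal.overlap {N p : ℕ} (h : Pal w N) (h' : Pal w (N + p)) : Pal w (N - p) := by
  intro k l hkl
  rw [← hasPer_of_pal h' h k (by omega)]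
  exact h _ _ (by omega)

theorem HasPer.eq_mod {N p : ℕ} (h : HasPer w N p) : ∀ k, k < N → w k = w (k % p) := by
  intro k
  induction k using Nat.strong_induction_on with
  | _ k ih =>
    intro hk
    rcases Nat.eq_zero_or_pos p with rfl | hp
    · simp
    by_cases hkp : k < p
    · rw [Nat.mod_eq_of_lt hkp]
    · have h1 := h (k - p) (by omega)
      rw [Nat.sub_add_cancel (by omega)] at h1
      rw [h1, ih (k - p) (by omega) (by omega), Nat.mod_eq_sub_mod (by omega : p ≤ k)]

theorem hasPer_of_eq_mod {N p g : ℕ} (hg : g ∣ p) (h : ∀ k, k < N → w k = w (k % g)) :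
    HasPer w N p := by
  intro k hk
  rw [h (k + p) hk, h k (by omega)]
  obtain ⟨c, rfl⟩ := hg
  simp

theorem HasPer.eq_of_modEq {N p k l : ℕ} (h : HasPer w N p) (hk : k < N) (hl : l < N)
    (hkl : k ≡ l [MOD p]) : w k = w l := by
  rw [h.eq_mod k hk, h.eq_mod l hl, hkl]

/-- A period of a full period word divides up the whole word. -/
theorem HasPer.refine {N M p g : ℕ} (h : HasPer w N p) (h' : HasPer w M g) (hp : 0 < p)
    (hpM : p ≤ M) (hg : g ∣ p) : HasPer w N g := by
  refine hasPer_of_eq_mod dvd_rfl fun k hk => ?_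
  have := Nat.mod_lt k hp
  rw [h.eq_mod k hk, h'.eq_mod (k % p) (by omega), Nat.mod_mod_of_dvd _ hg]

/-- The theorem of Fine and Wilf. -/
theorem fineWilf (s : ℕ) : ∀ {N p q : ℕ}, p + q ≤ s → 0 < p → 0 < q → HasPer w N p →
    HasPer w N q → p + q ≤ N + p.gcd q → HasPer w N (p.gcd q) := by
  induction s with
  | zero => intro N p q h hp; omega
  | succ s ih =>
    have main : ∀ {N p q : ℕ}, p + q ≤ s + 1 → 0 < p → p < q → HasPer w N p →
        HasPer w N q → p + q ≤ N + p.gcd q → HasPer w N (p.gcd q) := by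
      intro N p q hs hp hpq h1 h2 hN
      -- This bound yields `2 * p ≤ N`: the prefix of length `N - p` still contains a full period
      -- `p`, from which the gcd period spreads back to length `N`.
      have hgle : p.gcd q ≤ q - p := by
        have : p.gcd q ∣ q - p := Nat.dvd_sub (Nat.gcd_dvd_right p q) (Nat.gcd_dvd_left p q)
        exact Nat.le_of_dvd (by omega) this
      have hg : p.gcd (q - p) = p.gcd q := by
        rw [Nat.gcd_sub_self_right hpq.le]
      -- One step of the subtractive Euclidean algorithm.
      have h3 : HasPer w (N - p) (q - p) := by
        intro k hk
        rw [← h1 (k + (q - p)) (by omega), ← h2 k (by omega)]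
        congr 1
        omega
      have h4 := ih (N := N - p) (by omega) hp (by omega : 0 < q - p) (h1.mono (by omega)) h3
        (by omega)
      rw [hg] at h4
      exact h1.refine h4 hp (by omega) (Nat.gcd_dvd_left p q)
    intro N p q hs hp hq h1 h2 hN
    rcases lt_trichotomy p q with h | rfl | h
    · exact main hs hp h h1 h2 hN
    · simpa using h1
    · rw [Nat.gcd_comm]
      exact main (by omega) hq h h2 h1 (by rw [Nat.gcd_comm]; omega)

theorem HasPer.gcd {N p q : ℕ} (h1 : HasPer w N p) (h2 : HasPer w N q) (hp : 0 < p) (hq : 0 < q)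
    (hN : p + q ≤ N + 1) : HasPer w N (p.gcd q) :=
  fineWilf _ le_rfl hp hq h1 h2 (by have := Nat.gcd_pos_of_pos_left q hp; omega)

end Periods

/-! ### Enumerations of the palindromic prefixes -/

/-- `n 1 < n 2 < ⋯` is the list of all lengths of palindromic prefixes of `w`. -/
structure IsPalEnum {A : Type u} (w : ℕ → A) (n : ℕ → ℕ) : Prop where
  one : n 1 = 0
  lt_succ : ∀ i, 1 ≤ i → n i < n (i + 1)
  pal_iff : ∀ L, Pal w L ↔ ∃ i, 1 ≤ i ∧ n i = L

section Enum

variable {A : Type u} {w : ℕ → A} {n : ℕ → ℕ}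

theorem lt_of_lt_succ (h : ∀ i, 1 ≤ i → n i < n (i + 1)) {i j : ℕ} (hi : 1 ≤ i) (hij : i < j) :
    n i < n j := by
  induction j, hij using Nat.le_induction with
  | base => exact h i hi
  | succ j hj ih => exact ih.trans (h j (by omega))

theorem IsPalEnum.pal (h : IsPalEnum w n) {i : ℕ} (hi : 1 ≤ i) : Pal w (n i) :=
  (h.pal_iff _).2 ⟨i, hi, rfl⟩

theorem IsPalEnum.lt (h : IsPalEnum w n) {i j : ℕ} (hi : 1 ≤ i) (hij : i < j) : n i < n j :=
  lt_of_lt_succ h.lt_succ hi hij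

theorem IsPalEnum.le (h : IsPalEnum w n) {i j : ℕ} (hi : 1 ≤ i) (hij : i ≤ j) : n i ≤ n j := by
  rcases hij.eq_or_lt with rfl | hij
  · exact le_rfl
  · exact (h.lt hi hij).le

theorem IsPalEnum.lt_of_lt (h : IsPalEnum w n) {i j : ℕ} (hj : 1 ≤ j) (hij : n i < n j) :
    i < j := by
  by_contra hc
  exact absurd (h.le hj (not_lt.1 hc)) (by omega)

theorem IsPalEnum.not_pal (h : IsPalEnum w n) {i L : ℕ} (hi : 1 ≤ i) (h1 : n i < L)
    (h2 : L < n (i + 1)) : ¬ Pal w L := by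
  intro hL
  obtain ⟨j, hj, rfl⟩ := (h.pal_iff L).1 hL
  have := h.lt_of_lt hj h1
  have := h.lt_of_lt (by omega) h2
  omega

theorem isPalEnum_palLength (h : InfinitelyManyPal w) : IsPalEnum w (palLength w) := by
  refine ⟨?_, ?_, ?_⟩
  · unfold palLength
    exact Nat.nth_zero_of_zero (isPalLength_iff_pal.2 pal_zero)
  · intro i hi
    exact Nat.nth_strictMono h (by omega)
  · intro L
    rw [← isPalLength_iff_pal]
    constructor
    · intro hL
      obtain ⟨k, hk⟩ := Nat.exists_lt_card_nth_eq hL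
      exact ⟨k + 1, by omega, hk.2⟩
    · rintro ⟨i, -, rfl⟩
      exact Nat.nth_mem_of_infinite h _

theorem IsPalEnum.infinitelyManyPal (h : IsPalEnum w n) : InfinitelyManyPal w := by
  refine Set.infinite_of_injective_forall_mem (f := fun i => n (i + 1)) ?_ ?_
  · exact (strictMono_nat_of_lt_succ fun i => h.lt_succ (i + 1) (by omega)).injective
  · intro i
    exact isPalLength_iff_pal.2 (h.pal (by omega))

theorem IsPalEnum.unique {m : ℕ → ℕ} (h : IsPalEnum w n) (h' : IsPalEnum w m) :
    ∀ i, 1 ≤ i → n i = m i := by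
  have hr : Set.range (fun i => n (i + 1)) = Set.range (fun i => m (i + 1)) := by
    ext L
    have key : ∀ a : ℕ → ℕ, (∃ i, 1 ≤ i ∧ a i = L) ↔ ∃ i, a (i + 1) = L := fun a =>
      ⟨fun ⟨i, hi, e⟩ => ⟨i - 1, by rwa [Nat.sub_add_cancel hi]⟩, fun ⟨i, e⟩ => ⟨i + 1, by omega, e⟩⟩
    simp only [Set.mem_range]
    rw [← key, ← key, ← h.pal_iff, ← h'.pal_iff]
  have := (strictMono_nat_of_lt_succ fun i => h.lt_succ (i + 1) (by omega)).range_inj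
    (strictMono_nat_of_lt_succ fun i => h'.lt_succ (i + 1) (by omega)) |>.1 hr
  intro i hi
  have := congrFun this (i - 1)
  simpa [Nat.sub_add_cancel hi] using this

theorem ratioLimsup_congr {m : ℕ → ℕ} (h : ∀ i, 1 ≤ i → n i = m i) :
    ratioLimsup n = ratioLimsup m := by
  refine limsup_congr ?_
  filter_upwards [eventually_ge_atTop 1] with i hi
  rw [h i hi, h (i + 1) (by omega)]

theorem IsPalEnum.deltaWord_eq (h : IsPalEnum w n) : deltaWord w = ratioLimsup n := by
  rw [deltaWord, if_pos h.infinitelyManyPal]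
  exact ratioLimsup_congr ((isPalEnum_palLength h.infinitelyManyPal).unique h)

theorem IsPalEnum.hasAbundantPal (h : IsPalEnum w n) (h' : ∀ i, 1 ≤ i → n (i + 1) ≤ 2 * n i + 1) :
    HasAbundantPal w := by
  refine ⟨h.infinitelyManyPal, fun i hi => ?_⟩
  have := (isPalEnum_palLength h.infinitelyManyPal).unique h
  rw [this i hi, this (i + 1) (by omega)]
  exact h' i hi

/-- The overlap of the prefix and suffix occurrences is itself a palindromic prefix (`Pal.overlap`),
hence is listed. -/
theorem IsPalEnum.exists_overlap (h : IsPalEnum w n) {i : ℕ} (hi : 1 ≤ i)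
    (hle : n (i + 1) ≤ 2 * n i) : ∃ j, 1 ≤ j ∧ j < i ∧ n (i + 1) + n j = 2 * n i := by
  have hlt := h.lt_succ i hi
  obtain ⟨j, hj, hn⟩ := (h.pal_iff (n i - (n (i + 1) - n i))).1
    ((h.pal hi).overlap (by rw [Nat.add_sub_cancel' hlt.le]; exact h.pal (by omega)))
  exact ⟨j, hj, h.lt_of_lt hi (by omega), by omega⟩

end Enum

/-! ### From abundant words to reduced functions -/

section WordToFun

variable {A : Type u} {w : ℕ → A} {n : ℕ → ℕ}

theorem eq_add_mul_of_steps {s t d : ℕ} (hd : ∀ r, s ≤ r → r < t → n (r + 1) = n r + d) :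
    ∀ k, s + k ≤ t → n (s + k) = n s + k * d := by
  intro k
  induction k with
  | zero => simp
  | succ k ih =>
    intro hk
    have := hd (s + k) (by omega) (by omega)
    rw [← add_assoc, this, ih (by omega)]
    ring

theorem steps_eq {s t : ℕ}
    (hd : ∀ r, s < r → r < t → n (r + 1) + n (r - 1) = 2 * n r) (hs : n s ≤ n (s + 1)) :
    ∀ r, s ≤ r → r < t → n (r + 1) = n r + (n (s + 1) - n s) := by
  intro r hr
  induction r, hr using Nat.le_induction with
  | base => intro _; omega
  | succ r hr ih =>
    intro hrt
    have h1 := ih (by omega)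
    have h2 := hd (r + 1) (by omega) hrt
    simp only [Nat.add_sub_cancel] at h2
    omega

/-- If `n t` ends an arithmetic progression of palindromic lengths with common difference `d`, the
next palindromic prefix cannot come from a larger period divisible by `d`. -/
theorem IsPalEnum.not_dvd_step (h : IsPalEnum w n) {s t d p : ℕ} (hs : 1 ≤ s) (hst : s < t)
    (hd : ∀ r, s ≤ r → r < t → n (r + 1) = n r + d) (hp : n (t + 1) = n t + p) (hdp : d ∣ p)
    (hlt : d < p) (hpt : p ≤ n t + 1) (hper : HasPer w p d) : False := by
  have hd0 : 0 < d := by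
    have := hd s le_rfl hst
    have := h.lt_succ s hs
    omega
  have hP : HasPer w (n t + p) p :=
    hasPer_of_pal (by rw [← hp]; exact h.pal (by omega)) (h.pal (by omega))
  -- The period `d` of one block of length `p` spreads to length `n t + p`, so `n t + d` would be a
  -- palindromic length strictly between `n t` and `n (t + 1)`.
  have hD : HasPer w (n t + d) d := (hP.refine hper (by omega) le_rfl hdp).mono (by omega)
  exact h.not_pal (i := t) (by omega) (by omega) (by omega)
    ((h.pal (by omega)).extend hD (by omega))

theorem IsPalEnum.hasPer_of_steps (h : IsPalEnum w n) {s t d : ℕ} (hs : 1 ≤ s) (hst : s < t)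
    (hd : ∀ r, s ≤ r → r < t → n (r + 1) = n r + d) : HasPer w (n t) d := by
  have h1 := hd (t - 1) (by omega) (by omega)
  rw [Nat.sub_add_cancel (by omega)] at h1
  have h2 := h.pal (i := t) (by omega)
  rw [h1] at h2 ⊢
  exact hasPer_of_pal h2 (h.pal (by omega))

/-- Were `s ≤ j`, both `n j` and `n t` would lie in the progression, and the step `n t - n j = (t -
j) * d` would be a proper multiple of `d`. -/
theorem IsPalEnum.overlap_lt (h : IsPalEnum w n) {s t d j : ℕ} (hs : 1 ≤ s) (hst : s < t)
    (hd : ∀ r, s ≤ r → r < t → n (r + 1) = n r + d) (hjt : j + 2 ≤ t)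
    (ht : n (t + 1) + n j = 2 * n t) : j < s := by
  by_contra hc
  have h1 := eq_add_mul_of_steps hd (t - s) (by omega)
  have h2 := eq_add_mul_of_steps hd (j - s) (by omega)
  rw [Nat.add_sub_cancel' (by omega)] at h1 h2
  have h3 : (t - s) * d = (j - s) * d + (t - j) * d := by
    rw [← add_mul]; congr 1; omega
  have h4 : 2 * d ≤ (t - j) * d := Nat.mul_le_mul_right d (by omega)
  have hd0 := hd s le_rfl hst
  have := h.lt_succ s hs
  exact h.not_dvd_step hs hst hd (p := (t - j) * d) (by omega) (Dvd.intro_left _ rfl) (by omega)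
    (by omega) ((h.hasPer_of_steps hs hst hd).mono (by omega))

/-- Here `n s - n j = d`, so the step at `t` is `n t - n j = (t - s + 1) * d`. -/
theorem IsPalEnum.overlap_ne (h : IsPalEnum w n) {s t d j : ℕ} (hs : 1 ≤ s) (hst : s < t)
    (hd : ∀ r, s ≤ r → r < t → n (r + 1) = n r + d)
    (hsj : n (s + 1) + n j = 2 * n s) (ht : n (t + 1) + n j = 2 * n t) : False := by
  have h1 := eq_add_mul_of_steps hd (t - s) (by omega)
  rw [Nat.add_sub_cancel' (by omega)] at h1
  have h3 : (t - s + 1) * d = (t - s) * d + d := by ring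
  have h4 : 1 * d ≤ (t - s) * d := Nat.mul_le_mul_right d (by omega)
  have hd0 := hd s le_rfl hst
  have := h.lt_succ s hs
  exact h.not_dvd_step hs hst hd (p := (t - s + 1) * d) (by omega) (Dvd.intro_left _ rfl) (by omega)
    (by omega) ((h.hasPer_of_steps hs hst hd).mono (by omega))

/-- Here `n s + 1 = d`, so the step `n t + 1` is `(t - s + 1) * d`. Equal letters would extend the
period `d` by the one missing position `n t`, which is congruent to `n s` modulo `d`. -/
theorem IsPalEnum.letter_ne (h : IsPalEnum w n) {s t d : ℕ} (hs : 1 ≤ s) (hst : s < t)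
    (hd : ∀ r, s ≤ r → r < t → n (r + 1) = n r + d)
    (hsj : n (s + 1) = 2 * n s + 1) (ht : n (t + 1) = 2 * n t + 1) : w (n s) ≠ w (n t) := by
  intro hw
  have h1 := eq_add_mul_of_steps hd (t - s) (by omega)
  rw [Nat.add_sub_cancel' (by omega)] at h1
  have h3 : (t - s + 1) * d = (t - s) * d + d := by ring
  have h4 : 1 * d ≤ (t - s) * d := Nat.mul_le_mul_right d (by omega)
  have hd0 := hd s le_rfl hst
  have := h.lt_succ s hs
  have hper := h.hasPer_of_steps hs hst hd
  refine h.not_dvd_step hs hst hd (p := (t - s + 1) * d) (by omega) (Dvd.intro_left _ rfl)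
    (by omega) (by omega) fun k hk => ?_
  by_cases hk' : k + d < n t
  · exact hper k hk'
  · have hkt : k + d = n t := by omega
    rw [hkt, ← hw]
    refine hper.eq_of_modEq (by omega) (by omega) ?_
    refine Nat.ModEq.add_right_cancel' d ?_
    rw [hkt, h1]
    simp [Nat.ModEq]

/-- The value at `i` of the function associated with a word: a letter if `n (i + 1) = 2 n i + 1`,
and otherwise the index of the overlap of two consecutive occurrences of the `i`-th palindromic
prefix. -/
def Describes (w : ℕ → A) (n : ℕ → ℕ) (i : ℕ) (x : ℕ ⊕ A) : Prop :=
  (n (i + 1) = 2 * n i + 1 ∧ x = Sum.inr (w (n i))) ∨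
    ∃ j, 1 ≤ j ∧ j < i ∧ n (i + 1) + n j = 2 * n i ∧ x = Sum.inl j

theorem IsPalEnum.exists_describes (h : IsPalEnum w n) {i : ℕ} (hi : 1 ≤ i)
    (hle : n (i + 1) ≤ 2 * n i + 1) : ∃ x, Describes w n i x := by
  rcases hle.eq_or_lt with he | hl
  · exact ⟨_, Or.inl ⟨he, rfl⟩⟩
  · obtain ⟨j, h1, h2, h3⟩ := h.exists_overlap hi (by omega)
    exact ⟨_, Or.inr ⟨j, h1, h2, h3, rfl⟩⟩

theorem Describes.add_pred {ψ : ℕ → ℕ ⊕ A} {i : ℕ} (h : Describes w n i (ψ i)) (hi : 1 ≤ i)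
    (hb : ¬ IsBreak ψ i) : n (i + 1) + n (i - 1) = 2 * n i := by
  rcases h with ⟨-, h⟩ | ⟨j, h1, h2, h3, h⟩
  · exact absurd ⟨hi, Or.inl ⟨_, h⟩⟩ hb
  · have : ¬ j + 2 ≤ i := fun hc => hb ⟨hi, Or.inr ⟨j, h, h1, hc⟩⟩
    rwa [show i - 1 = j by omega]

theorem IsPalEnum.reduced_of_describes (h : IsPalEnum w n) {ψ : ℕ → ℕ ⊕ A} {s t : ℕ}
    (hd : ∀ r, s ≤ r → r ≤ t → Describes w n r (ψ r)) (hst : ConsecutiveBreaks ψ s t) :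
    ψ t ≠ ψ s ∧ ((∃ a : A, ψ t = Sum.inr a) ∨ ∃ m : ℕ, ψ t = Sum.inl m ∧ m < s) := by
  obtain ⟨hbs, hbt, hlt, hno⟩ := hst
  have hs := hbs.1
  have hsteps := steps_eq (fun r h1 h2 =>
    (hd r h1.le h2.le).add_pred (by omega) (hno r h1 h2)) (h.lt_succ s hs).le
  rcases hd t hlt.le le_rfl with ⟨ht, et⟩ | ⟨j, hj, hjt, ht, et⟩
  · refine ⟨?_, Or.inl ⟨_, et⟩⟩
    rcases hd s le_rfl hlt.le with ⟨hs', es⟩ | ⟨j', -, -, -, es⟩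
    · rw [et, es]
      intro hc
      exact h.letter_ne hs hlt hsteps hs' ht (Sum.inr_injective hc).symm
    · simp [et, es]
  · have hj2 : j + 2 ≤ t := by
      rcases hbt.2 with ⟨a, ha⟩ | ⟨m, hm, -, hm2⟩
      · simp [et] at ha
      · rw [et] at hm
        rwa [Sum.inl_injective hm]
    refine ⟨?_, Or.inr ⟨j, et, h.overlap_lt hs hlt hsteps hj2 ht⟩⟩
    rcases hd s le_rfl hlt.le with ⟨-, es⟩ | ⟨j', -, -, hs', es⟩
    · simp [et, es]
    · rw [et, es]
      intro hc
      have := Sum.inl_injective hc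
      subst this
      exact h.overlap_ne hs hlt hsteps hs' ht

/-- Every word with abundant palindromic prefixes comes from a reduced function. -/
theorem IsPalEnum.exists_isReduced (h : IsPalEnum w n)
    (hab : ∀ i, 1 ≤ i → n (i + 1) ≤ 2 * n i + 1) :
    ∃ ψ : ℕ → ℕ ⊕ A, IsReduced ψ ∧ ∀ i, 1 ≤ i → recSeq ψ i = n i := by
  have hex : ∀ i, ∃ x, 1 ≤ i → Describes w n i x := by
    intro i
    by_cases hi : 1 ≤ i
    · obtain ⟨x, hx⟩ := h.exists_describes hi (hab i hi)
      exact ⟨x, fun _ => hx⟩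
    · exact ⟨Sum.inl 0, fun hc => absurd hc hi⟩
  choose ψ hψ using hex
  have hdir : IsDirective ψ := by
    intro i hi m hm
    rcases hψ i hi with ⟨-, e⟩ | ⟨j, h1, h2, -, e⟩
    · simp [e] at hm
    · rw [e] at hm
      rw [← Sum.inl_injective hm]
      exact ⟨h1, h2⟩
  refine ⟨ψ, ⟨hdir, fun s t hst =>
    h.reduced_of_describes (fun r hr _ => hψ r (hst.1.1.trans hr)) hst⟩, ?_⟩
  intro i
  induction i using Nat.strong_induction_on with
  | _ i ih =>
    intro hi
    rcases hi.eq_or_lt with rfl | hi1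
    · rw [recSeq_one, h.one]
    · obtain ⟨k, rfl⟩ : ∃ k, i = k + 1 := ⟨i - 1, by omega⟩
      have hk : 1 ≤ k := by omega
      have ek := ih k (by omega) hk
      rcases hψ k hk with ⟨e, e'⟩ | ⟨j, h1, h2, e, e'⟩
      · rw [recSeq_succ_of_inr ψ hk e', ek, e]
      · rw [recSeq_succ_of_inl ψ hdir hk e', ek, ih j (by omega) h1]
        omega

end WordToFun

theorem setD₀_subset_reducedValues : setD₀.{u} ⊆ reducedValues.{u} := by
  rintro x ⟨A, w, hw, rfl⟩
  have h := isPalEnum_palLength hw.1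
  obtain ⟨ψ, hψ, e⟩ := h.exists_isReduced hw.2
  exact ⟨A, ψ, hψ, by rw [h.deltaWord_eq]; exact ratioLimsup_congr e⟩

/-! ### From reduced functions to words -/

section FunToWord

/-- The index `i ≥ 1` such that `n i ≤ k < n (i + 1)`. -/
def blockIndex (n : ℕ → ℕ) (k : ℕ) : ℕ := Nat.findGreatest (fun i => n i ≤ k) (k + 1)

theorem le_of_lt_succ {n : ℕ → ℕ} (h : ∀ i, 1 ≤ i → n i < n (i + 1)) (i : ℕ) : i ≤ n (i + 1) := by
  induction i with
  | zero => omega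
  | succ i ih => have := h (i + 1) (by omega); omega

theorem blockIndex_spec {n : ℕ → ℕ} (h1 : n 1 = 0) (h : ∀ i, 1 ≤ i → n i < n (i + 1)) (k : ℕ) :
    1 ≤ blockIndex n k ∧ n (blockIndex n k) ≤ k ∧ k < n (blockIndex n k + 1) := by
  have hP : n 1 ≤ k := by omega
  have hge : 1 ≤ blockIndex n k :=
    Nat.le_findGreatest (P := fun i => n i ≤ k) (by omega) hP
  have hle : n (blockIndex n k) ≤ k :=
    Nat.findGreatest_spec (P := fun i => n i ≤ k) (by omega : 1 ≤ k + 1) hP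
  refine ⟨hge, hle, ?_⟩
  by_contra hc
  have hb : blockIndex n k ≤ k + 1 := Nat.findGreatest_le _
  by_cases hb' : blockIndex n k + 1 ≤ k + 1
  · exact Nat.findGreatest_is_greatest (P := fun i => n i ≤ k) (Nat.lt_succ_self _) hb'
      (not_lt.1 hc)
  · have := le_of_lt_succ h (blockIndex n k)
    omega

theorem blockIndex_eq {n : ℕ → ℕ} (h1 : n 1 = 0) (h : ∀ i, 1 ≤ i → n i < n (i + 1)) {i k : ℕ}
    (hi : 1 ≤ i) (hik : n i ≤ k) (hki : k < n (i + 1)) : blockIndex n k = i := by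
  obtain ⟨h2, h3, h4⟩ := blockIndex_spec h1 h k
  rcases lt_trichotomy (blockIndex n k) i with hlt | he | hlt
  · rcases (Nat.succ_le_of_lt hlt).eq_or_lt with he | hl
    · rw [Nat.succ_eq_add_one] at he
      rw [he] at h4
      omega
    · have := lt_of_lt_succ h (by omega) hl
      rw [Nat.succ_eq_add_one] at this
      omega
  · exact he
  · rcases (Nat.succ_le_of_lt hlt).eq_or_lt with he | hl
    · rw [Nat.succ_eq_add_one] at he
      rw [← he] at h3
      omega
    · have := lt_of_lt_succ h (by omega) hl
      rw [Nat.succ_eq_add_one] at this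
      omega

variable {A : Type u} {w : ℕ → A} {n : ℕ → ℕ} {ψ : ℕ → ℕ ⊕ A}

/-- The word whose palindromic prefixes are described by `ψ`. -/
def wordOf (ψ : ℕ → ℕ ⊕ A) (a₀ : A) (k : ℕ) : A :=
  if _h : 0 < recSeq ψ (blockIndex (recSeq ψ) k + 1) - recSeq ψ (blockIndex (recSeq ψ) k) ∧
      recSeq ψ (blockIndex (recSeq ψ) k + 1) - recSeq ψ (blockIndex (recSeq ψ) k) ≤ k then
    wordOf ψ a₀
      (k - (recSeq ψ (blockIndex (recSeq ψ) k + 1) - recSeq ψ (blockIndex (recSeq ψ) k)))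
  -- For directive `ψ` the block's step is positive and at most `n i + 1`, so this branch is reached
  -- only at `k = n i` with `ψ i` a letter; `a₀` is never used.
  else Sum.elim (fun _ => a₀) id (ψ (blockIndex (recSeq ψ) k))
termination_by k

theorem recSeq_lt_succ (hψ : IsDirective ψ) (i : ℕ) (hi : 1 ≤ i) :
    recSeq ψ i < recSeq ψ (i + 1) :=
  recSeq_lt_of_lt ψ hψ (i + 1) i hi (Nat.lt_succ_self i)

theorem recSeq_cases (hψ : IsDirective ψ) {i : ℕ} (hi : 1 ≤ i) :
    (∃ a, ψ i = Sum.inr a ∧ recSeq ψ (i + 1) = 2 * recSeq ψ i + 1) ∨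
      ∃ m, ψ i = Sum.inl m ∧ 1 ≤ m ∧ m < i ∧ recSeq ψ (i + 1) + recSeq ψ m = 2 * recSeq ψ i := by
  rcases h : ψ i with m | a
  · obtain ⟨h1, h2⟩ := hψ i hi m h
    have := recSeq_lt_of_lt ψ hψ i m h1 h2
    have := recSeq_succ_of_inl ψ hψ hi h
    exact Or.inr ⟨m, rfl, h1, h2, by omega⟩
  · exact Or.inl ⟨a, rfl, recSeq_succ_of_inr ψ hi h⟩

theorem recSeq_succ_le (hψ : IsDirective ψ) {i : ℕ} (hi : 1 ≤ i) :
    recSeq ψ (i + 1) ≤ 2 * recSeq ψ i + 1 := by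
  rcases recSeq_cases hψ hi with ⟨a, -, h⟩ | ⟨m, -, -, -, h⟩ <;> omega

theorem wordOf_eq (hψ : IsDirective ψ) (a₀ : A) {i k : ℕ} (hi : 1 ≤ i)
    (hik : recSeq ψ i ≤ k + (recSeq ψ (i + 1) - recSeq ψ i)) (hk : k < recSeq ψ i) :
    wordOf ψ a₀ (k + (recSeq ψ (i + 1) - recSeq ψ i)) = wordOf ψ a₀ k := by
  have hlt := recSeq_lt_succ hψ i hi
  have hb := blockIndex_eq (recSeq_one ψ) (recSeq_lt_succ hψ) hi hik (by omega)
  rw [wordOf, hb, dif_pos ⟨by omega, by omega⟩, Nat.add_sub_cancel]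

theorem wordOf_letter (hψ : IsDirective ψ) (a₀ : A) {i : ℕ} (hi : 1 ≤ i) {a : A}
    (ha : ψ i = Sum.inr a) : wordOf ψ a₀ (recSeq ψ i) = a := by
  have hlt := recSeq_succ_of_inr ψ hi ha
  have hb := blockIndex_eq (recSeq_one ψ) (recSeq_lt_succ hψ) hi le_rfl (by omega)
  rw [wordOf, hb, dif_neg (by omega), ha]
  rfl

/-- Past `n i` the period is built into the word; before, it comes from the palindromic prefix of
length `n m`, `m = ψ i`, inside that of length `n i`. -/
theorem hasPer_wordOf (hψ : IsDirective ψ) (a₀ : A) {i : ℕ} (hi : 1 ≤ i)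
    (h : ∀ m, 1 ≤ m → m ≤ i → Pal (wordOf ψ a₀) (recSeq ψ m)) :
    HasPer (wordOf ψ a₀) (recSeq ψ (i + 1)) (recSeq ψ (i + 1) - recSeq ψ i) := by
  intro k hk
  have hlt := recSeq_lt_succ hψ i hi
  by_cases hik : recSeq ψ i ≤ k + (recSeq ψ (i + 1) - recSeq ψ i)
  · exact wordOf_eq hψ a₀ hi hik (by omega)
  · rcases recSeq_cases hψ hi with ⟨a, -, e⟩ | ⟨m, -, h1, h2, e⟩
    · omega
    · have e' : recSeq ψ i = recSeq ψ m + (recSeq ψ (i + 1) - recSeq ψ i) := by omega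
      have hp := h i hi le_rfl
      rw [e'] at hp
      exact hasPer_of_pal hp (h m h1 h2.le) k (by omega)

theorem pal_wordOf (hψ : IsDirective ψ) (a₀ : A) (i : ℕ) :
    1 ≤ i → Pal (wordOf ψ a₀) (recSeq ψ i) := by
  induction i using Nat.strong_induction_on with
  | _ i ih =>
    intro hi
    rcases hi.eq_or_lt with rfl | hi1
    · rw [recSeq_one]; exact pal_zero
    · obtain ⟨k, rfl⟩ : ∃ k, i = k + 1 := ⟨i - 1, by omega⟩
      have hk : 1 ≤ k := by omega
      have hper := hasPer_wordOf hψ a₀ hk fun m h1 h2 => ih m (by omega) h1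
      have hlt := recSeq_lt_succ hψ k hk
      have hle := recSeq_succ_le hψ hk
      have e : recSeq ψ (k + 1) = recSeq ψ k + (recSeq ψ (k + 1) - recSeq ψ k) := by omega
      rw [e]
      exact (ih k (by omega) hk).extend (by rwa [← e]) (by omega)

/-- A palindrome of length `N ≥ 2d - 1` extended with period `d` to the next palindromic prefix has
no proper palindromic prefix longer than `N - d`. -/
theorem Pal.no_long_border {N d r : ℕ} (hN : Pal w N) (hd : HasPer w (N + d) d)
    (hdN : 2 * d ≤ N + 1) (hmin : ∀ g, 0 < g → g < d → ¬ Pal w (N + g)) (hr : Pal w r)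
    (hdr : N < r + d) (hrN : r < N) : False := by
  have he : HasPer w N (N - r) := by
    have := hasPer_of_pal (w := w) (M := r) (p := N - r)
      (by rwa [Nat.add_sub_cancel' hrN.le]) hr
    rwa [Nat.add_sub_cancel' hrN.le] at this
  -- By Fine and Wilf, `g = gcd (N - r) d < d` is a period, and then `N + g` is a palindromic
  -- length, against `hmin`.
  have hg := he.gcd (hd.mono (by omega)) (by omega) (by omega) (by omega)
  have hg0 : 0 < (N - r).gcd d := Nat.gcd_pos_of_pos_left d (by omega)
  have hgle : (N - r).gcd d ≤ N - r := Nat.gcd_le_left d (by omega)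
  exact hmin _ hg0 (by omega) (hN.extend
    ((hd.refine hg (by omega) (by omega) (Nat.gcd_dvd_right _ _)).mono (by omega)) (by omega))

theorem isBreak_one (hψ : IsDirective ψ) : IsBreak ψ 1 := by
  refine ⟨le_rfl, ?_⟩
  rcases h : ψ 1 with m | a
  · have := hψ 1 le_rfl m h
    omega
  · exact Or.inl ⟨a, rfl⟩

theorem eq_pred_of_not_isBreak (hψ : IsDirective ψ) {i : ℕ} (hi : 1 ≤ i) (h : ¬ IsBreak ψ i) :
    ψ i = Sum.inl (i - 1) := by
  rcases e : ψ i with m | a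
  · have hm := hψ i hi m e
    have : ¬ m + 2 ≤ i := fun hc => h ⟨hi, Or.inr ⟨m, e, hm.1, hc⟩⟩
    rw [show m = i - 1 by omega]
  · exact absurd ⟨hi, Or.inl ⟨a, e⟩⟩ h

theorem exists_consecutiveBreaks {r i : ℕ} (hr : IsBreak ψ r) (hi : IsBreak ψ i) (hri : r < i) :
    ∃ s, r ≤ s ∧ ConsecutiveBreaks ψ s i := by
  classical
  have h1 : r ≤ i - 1 := by omega
  have hle : Nat.findGreatest (IsBreak ψ) (i - 1) ≤ i - 1 := Nat.findGreatest_le _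
  exact ⟨Nat.findGreatest (IsBreak ψ) (i - 1), Nat.le_findGreatest h1 hr,
    Nat.findGreatest_spec h1 hr, hi, by omega,
    fun q hq1 hq2 => Nat.findGreatest_is_greatest hq1 (by omega)⟩

/-- Take the first extra length `n i + q`, and let `p` be the step at `i`. Then `q` divides `p`, and
`q` is also the common step from the previous break `s` up to `i`. Comparing the overlaps or letters
at `s` and `i`, either `ψ i = ψ s`, or the divisibility fails, or `n s` is so long compared with `q`
that the palindromic prefix of length `n (s - 1)` is a forbidden border. -/
theorem not_pal_wordOf (hψ : IsReduced ψ) (a₀ : A) (i : ℕ) : 1 ≤ i → ∀ L, recSeq ψ i < L →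
    L < recSeq ψ (i + 1) → ¬ Pal (wordOf ψ a₀) L := by
  induction i using Nat.strong_induction_on with
  | _ i ih =>
  intro hi L₀ hL₀ hL₀' hpal₀
  have hdir := hψ.1
  have hpal := pal_wordOf hdir a₀
  have hinc := recSeq_lt_succ hdir
  set w := wordOf ψ a₀
  set n := recSeq ψ with hn
  classical
  have hex : ∃ q, 0 < q ∧ Pal w (n i + q) := ⟨L₀ - n i, by omega, by
    rwa [Nat.add_sub_cancel' hL₀.le]⟩
  obtain ⟨q, ⟨hq0, hq⟩, hmin⟩ : ∃ q, (0 < q ∧ Pal w (n i + q)) ∧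
      ∀ g, 0 < g → g < q → ¬ Pal w (n i + g) :=
    ⟨Nat.find hex, Nat.find_spec hex, fun g h1 h2 h3 => Nat.find_min hex h2 ⟨h1, h3⟩⟩
  have hqL : n i + q ≤ L₀ := by
    by_contra hc
    exact hmin (L₀ - n i) (by omega) (by omega) (by rwa [Nat.add_sub_cancel' hL₀.le])
  have hle := recSeq_succ_le hdir hi
  rw [← hn] at hle
  obtain ⟨p, hp⟩ : ∃ p, n (i + 1) = n i + p := ⟨n (i + 1) - n i, by omega⟩
  have hqp : q < p := by omega
  have hPer : HasPer w (n i + p) p := by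
    have h1 := hasPer_of_pal (w := w) (M := n i) (p := p) (by rw [← hp]; exact hpal _ (by omega))
      (hpal i hi)
    exact h1
  have hqper : HasPer w (n i + q) q := hasPer_of_pal hq (hpal i hi)
  have hdvd : q ∣ p := by
    -- Fine and Wilf applies since `p ≤ n i + 1`; a gcd below `q` would give an earlier extra
    -- palindrome.
    have hg := hqper.gcd (hPer.mono (by omega)) hq0 (by omega) (by omega)
    have hg0 : 0 < q.gcd p := Nat.gcd_pos_of_pos_left p hq0
    have hgle : q.gcd p ≤ q := Nat.gcd_le_left p hq0
    rcases hgle.eq_or_lt with he | hlt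
    · rw [← he]; exact Nat.gcd_dvd_right q p
    · exact absurd ((hpal i hi).extend (hg.mono (by omega)) (by omega)) (hmin _ hg0 hlt)
  have h2q : 2 * q ≤ p := by
    obtain ⟨c, rfl⟩ := hdvd
    have : 2 ≤ c := by
      by_contra hc
      have : c = 0 ∨ c = 1 := by omega
      rcases this with rfl | rfl <;> omega
    nlinarith
  -- the overlap is the previous palindromic prefix
  have hi1 : 1 < i := by
    by_contra hc
    have : i = 1 := by omega
    subst this
    have : n 1 = 0 := recSeq_one ψ
    omega
  have hpred : n i = n (i - 1) + q := by
    have hov := (hpal i hi).overlap hq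
    obtain ⟨h1, h2, h3⟩ := blockIndex_spec (recSeq_one ψ) hinc (n i - q)
    rw [← hn] at h1 h2 h3
    set m := blockIndex n (n i - q)
    have hmi : m < i := by
      by_contra hc
      rcases (not_lt.1 hc).eq_or_lt with he | hl
      · rw [← he] at h2; omega
      · have := lt_of_lt_succ hinc hi hl
        omega
    have hm : n m = n i - q := by
      by_contra hc
      exact ih m hmi h1 _ (by omega) h3 hov
    rcases (show m = i - 1 ∨ m < i - 1 by omega) with he | hl
    · rw [← he]; omega
    · exfalso
      have h4 := lt_of_lt_succ hinc h1 hl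
      have h5 := lt_of_lt_succ hinc (by omega : 1 ≤ i - 1) (by omega : i - 1 < i)
      exact (hpal i hi).no_long_border hqper (by omega) hmin (hpal (i - 1) (by omega)) (by omega) h5
  have hbi : IsBreak ψ i := by
    by_contra hb
    have h1 := eq_pred_of_not_isBreak hdir hi hb
    have h2 := recSeq_succ_of_inl ψ hdir hi h1
    rw [← hn] at h2
    omega
  obtain ⟨s, hs, hcons⟩ := exists_consecutiveBreaks (isBreak_one hdir) hbi hi1
  obtain ⟨hbs, -, hsi, hno⟩ := id hcons
  obtain ⟨hne, hred⟩ := hψ.2 s i hcons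
  have hsteps := steps_eq (n := n) (s := s) (t := i) (fun r h1 h2 => by
    have h3 := recSeq_succ_of_inl ψ hdir (by omega) (eq_pred_of_not_isBreak hdir (by omega)
      (hno r h1 h2))
    have h4 := lt_of_lt_succ hinc (by omega : 1 ≤ r - 1) (by omega : r - 1 < r)
    rw [← hn] at h3
    omega) (hinc s hs).le
  have hqs : n (s + 1) - n s = q := by
    have := hsteps (i - 1) (by omega) (by omega)
    rw [Nat.sub_add_cancel hi] at this
    omega
  rw [hqs] at hsteps
  have hs1 := hsteps s le_rfl hsi
  have his := eq_add_mul_of_steps hsteps (i - s) (by omega)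
  rw [Nat.add_sub_cancel' hsi.le] at his
  have hdm : q ∣ (i - s) * q := Dvd.intro_left _ rfl
  -- Since `s` is a break, `m ≤ s - 2`, so `n s - q = n m < n (s - 1) < n s`; `Pal.no_long_border`
  -- excludes this.
  have key : 2 * q ≤ n s + 1 → ∀ m, ψ s = Sum.inl m → False := by
    intro h2 m hm
    have hms : m + 2 ≤ s := by
      rcases hbs.2 with ⟨a, ha⟩ | ⟨m', h1, -, h3⟩
      · simp [ha] at hm
      · rw [hm] at h1
        rwa [Sum.inl_injective h1]
    have hm1 := (hdir s hs m hm).1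
    have h3 := recSeq_succ_of_inl ψ hdir hs hm
    rw [← hn] at h3
    have h4 := lt_of_lt_succ hinc hm1 (by omega : m < s - 1)
    have h5 := lt_of_lt_succ hinc (by omega : 1 ≤ s - 1) (by omega : s - 1 < s)
    refine (hpal s hs).no_long_border (d := q) (hqper.mono ?_) h2 (fun g h6 h7 =>
      ih s hsi hs _ (by omega) (by omega)) (hpal (s - 1) (by omega)) (by omega) h5
    have := lt_of_lt_succ hinc hs hsi
    omega
  rcases hred with ⟨a, ha⟩ | ⟨j, hj, hjs⟩
  · have h1 := recSeq_succ_of_inr ψ hi ha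
    rw [← hn] at h1
    have hd1 : q ∣ n s + 1 := by
      rw [show p = (n s + 1) + (i - s) * q by omega] at hdvd
      exact (Nat.dvd_add_left hdm).1 hdvd
    rcases recSeq_cases hdir hs with ⟨a', ha', e⟩ | ⟨m, hm, h3, h4, e⟩
    -- Two letters: `q = n s + 1` is a period, and `n i` is congruent to `n s` modulo `q`.
    · refine hne ?_
      have wa : w (n i) = a := wordOf_letter hdir a₀ hi ha
      have wa' : w (n s) = a' := wordOf_letter hdir a₀ hs ha'
      rw [ha, ha', ← wa, ← wa']
      congr 1
      refine hqper.eq_of_modEq (by omega) (by omega) ?_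
      rw [his]
      simp [Nat.ModEq]
    · rw [← hn] at e
      refine key ?_ m hm
      obtain ⟨c, hc⟩ := hd1
      have : 2 ≤ c := by
        by_contra hc'
        have : c = 0 ∨ c = 1 := by omega
        rcases this with rfl | rfl <;> omega
      nlinarith
  · have h1 := recSeq_succ_of_inl ψ hdir hi hj
    rw [← hn] at h1
    have hj1 := (hdir i hi j hj).1
    have hjs' := lt_of_lt_succ hinc hj1 hjs
    have hd1 : q ∣ n s - n j := by
      rw [show p = (n s - n j) + (i - s) * q by omega] at hdvd
      exact (Nat.dvd_add_left hdm).1 hdvd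
    rcases recSeq_cases hdir hs with ⟨a', ha', e⟩ | ⟨m, hm, h3, h4, e⟩
    · rw [← hn] at e
      have := Nat.le_of_dvd (by omega) hd1
      omega
    · rw [← hn] at e
      refine key ?_ m hm
      obtain ⟨c, hc⟩ := hd1
      have : 2 ≤ c := by
        by_contra hc'
        have hc2 : c = 0 ∨ c = 1 := by omega
        rcases hc2 with rfl | rfl
        · omega
        -- A quotient of 1 means that the overlaps at `i` and `s` coincide.
        · have hjm : n j = n m := by omega
          refine hne ?_
          rw [hj, hm]
          rcases lt_trichotomy j m with h | h | h
          · have := lt_of_lt_succ hinc hj1 h; omega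
          · rw [h]
          · have := lt_of_lt_succ hinc h3 h; omega
      nlinarith [Nat.sub_le (n s) (n j)]

theorem IsReduced.isPalEnum (hψ : IsReduced ψ) (a₀ : A) :
    IsPalEnum (wordOf ψ a₀) (recSeq ψ) := by
  refine ⟨recSeq_one ψ, recSeq_lt_succ hψ.1, fun L => ⟨fun hL => ?_, ?_⟩⟩
  · obtain ⟨h1, h2, h3⟩ := blockIndex_spec (recSeq_one ψ) (recSeq_lt_succ hψ.1) L
    refine ⟨_, h1, ?_⟩
    by_contra hc
    exact not_pal_wordOf hψ a₀ _ h1 L (by omega) h3 hL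
  · rintro ⟨i, hi, rfl⟩
    exact pal_wordOf hψ.1 a₀ i hi

end FunToWord

theorem reducedValues_subset_setD₀ : reducedValues.{u} ⊆ setD₀.{u} := by
  rintro x ⟨A, ψ, hψ, rfl⟩
  obtain ⟨a₀, -⟩ : ∃ a, ψ 1 = Sum.inr a := by
    rcases recSeq_cases hψ.1 le_rfl with ⟨a, ha, -⟩ | ⟨m, -, h1, h2, -⟩
    · exact ⟨a, ha⟩
    · omega
  have h := hψ.isPalEnum a₀
  exact ⟨A, wordOf ψ a₀, h.hasAbundantPal fun i hi => recSeq_succ_le hψ.1 hi, h.deltaWord_eq⟩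

/-! ### A Harnack inequality for the recurrence -/

section Harnack

variable {A : Type u} {ψ : ℕ → ℕ ⊕ A} {K : ℕ}

/-- `x` satisfies the recurrence given by `ψ` from the index `K` on. -/
def Follows (ψ : ℕ → ℕ ⊕ A) (K : ℕ) (x : ℕ → ℝ) : Prop :=
  ∀ i, K ≤ i → ∀ m, ψ i = Sum.inl m → x (i + 1) = 2 * x i - x m

theorem Follows.sub_mul {x y : ℕ → ℝ} (hx : Follows ψ K x) (hy : Follows ψ K y) (a b : ℝ) :
    Follows ψ K fun i => a * x i - b * y i := by
  intro i hi m hm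
  simp only [hx i hi m hm, hy i hi m hm]
  ring

theorem Follows.step_eq {x : ℕ → ℝ} (hψ : IsDirective ψ) (hx : Follows ψ K x) {i : ℕ} (hi : 1 ≤ i)
    (hK : K ≤ i) (hb : ¬ IsBreak ψ i) : x (i + 1) - x i = x i - x (i - 1) := by
  rw [hx i hK _ (eq_pred_of_not_isBreak hψ hi hb)]
  ring

theorem Follows.steps {x : ℕ → ℝ} (hψ : IsDirective ψ) (hx : Follows ψ K x) {s t : ℕ} (hs : K ≤ s)
    (hst : s < t) (hno : ∀ r, s < r → r < t → ¬ IsBreak ψ r) :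
    x t - x (t - 1) = x (s + 1) - x s ∧ x t - x s = ((t - s : ℕ) : ℝ) * (x t - x (t - 1)) := by
  induction t, hst using Nat.le_induction with
  | base => simp
  | succ t hst ih =>
    obtain ⟨h1, h2⟩ := ih fun r h1 h2 => hno r h1 (by omega)
    have h3 := hx.step_eq hψ (by omega) (by omega) (hno t hst (by omega))
    simp only [Nat.add_sub_cancel]
    refine ⟨by rw [h3, h1], ?_⟩
    rw [show t + 1 - s = (t - s) + 1 by omega, h3]
    push_cast
    linarith

theorem sub_le_sub_of_steps {x : ℕ → ℝ} {a b : ℕ} (hab : a ≤ b)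
    (h : ∀ j, a ≤ j → j < b → x j ≤ x (j + 1)) : x a ≤ x b := by
  induction b, hab using Nat.le_induction with
  | base => exact le_rfl
  | succ b hab ih => exact (ih fun j h1 h2 => h j h1 (by omega)).trans (h b hab (by omega))

theorem exists_prev_break (hψ : IsReduced ψ) (hK : IsBreak ψ K) {t m : ℕ} (ht : IsBreak ψ t) (hKt : K < t)
    (hm : ψ t = Sum.inl m) :
    ∃ s, K ≤ s ∧ s < t ∧ IsBreak ψ s ∧ (∀ r, s < r → r < t → ¬ IsBreak ψ r) ∧ m < s := by
  obtain ⟨s, hs, hc⟩ := exists_consecutiveBreaks hK ht hKt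
  refine ⟨s, hs, hc.2.2.1, hc.1, hc.2.2.2, ?_⟩
  rcases (hψ.2 s t hc).2 with ⟨a, ha⟩ | ⟨m', h1, h2⟩
  · simp [ha] at hm
  · rw [hm] at h1
    rwa [Sum.inl_injective h1]

/-- At a break, the increment is at least `n (t - 1)`, up to a constant. -/
theorem le_step_add_of_isBreak (hψ : IsReduced ψ) (hK : IsBreak ψ K)
    (hinl : ∀ i, K ≤ i → ∃ m, ψ i = Sum.inl m) {n : ℕ → ℝ} (hn : Follows ψ K n)
    (hinc : ∀ i, 1 ≤ i → n i < n (i + 1)) (t : ℕ) :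
    K ≤ t → IsBreak ψ t → n (t - 1) ≤ n (t + 1) - n t + n (K - 1) := by
  induction t using Nat.strong_induction_on with
  | _ t ih =>
    intro hKt ht
    have hK1 := hK.1
    rcases hKt.eq_or_lt with rfl | hKt'
    · have := hinc K hK1
      linarith
    · obtain ⟨m, hm⟩ := hinl t hKt
      obtain ⟨s, hs, hst, hbs, hno, hms⟩ := exists_prev_break hψ hK ht hKt' hm
      have h1 := ih s hst hs hbs
      have h2 := (hn.steps hψ.1 hs hst hno).1
      have h3 := hn t hKt m hm
      have hm1 := (hψ.1 t (by omega) m hm).1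
      -- By induction `n (s - 1)` is at most the step at `s`, up to `n (K - 1)`, and that step
      -- persists until `t`.
      have h4 : n m ≤ n (s - 1) :=
        sub_le_sub_of_steps (by omega) fun j h _ => (hinc j (by omega)).le
      linarith

/-- Off breaks both increments, hence their quotient, are unchanged. At a break `t`, let `s` be the
previous break and `m = ψ t < s`. The new increment `x t - x m` is at least `x t - x s`, which is `t
- s` old increments, while that of `n` is at most `4 * (n t - n s)`: the quotient loses at most a
factor 4. Meanwhile `n` grows by at least 5/4, and `(5/4)^7 > 4`. -/
theorem harnack_step (hψ : IsReduced ψ) (hK : IsBreak ψ K)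
    (hinl : ∀ i, K ≤ i → ∃ m, ψ i = Sum.inl m) {n : ℕ → ℝ} (hn : Follows ψ K n)
    (hinc : ∀ i, 1 ≤ i → n i < n (i + 1)) (hn0 : ∀ i, 0 ≤ n i) {x : ℕ → ℝ} (hx : Follows ψ K x)
    {N t : ℕ} (hxN : ∀ j, N ≤ j → x j ≤ x (j + 1)) (hKt : K < t) (hNt : N < t)
    (hmN : ∀ m, ψ t = Sum.inl m → N ≤ m) (hlarge : 6 * n (K - 1) ≤ n t) :
    (x t - x (t - 1)) / (n t - n (t - 1)) * n t ^ 7 ≤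
      (x (t + 1) - x t) / (n (t + 1) - n t) * n (t + 1) ^ 7 := by
  have hK1 := hK.1
  have hc := hinc t (by omega)
  have hc' := hinc (t - 1) (by omega)
  have he := hxN t hNt.le
  have he' := hxN (t - 1) (by omega)
  rw [Nat.sub_add_cancel (by omega)] at hc' he'
  have hnt := hn0 t
  by_cases hb : IsBreak ψ t
  · obtain ⟨m, hm⟩ := hinl t hKt.le
    obtain ⟨s, hs, hst, hbs, hno, hms⟩ := exists_prev_break hψ hK hb hKt hm
    have hD := le_step_add_of_isBreak hψ hK hinl hn hinc
    have h1 := hD s hs hbs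
    have h2 := hD t hKt.le hb
    obtain ⟨h3, h4⟩ := hn.steps hψ.1 hs hst hno
    obtain ⟨-, h5⟩ := hx.steps hψ.1 hs hst hno
    have h6 := hn t hKt.le m hm
    have h7 := hx t hKt.le m hm
    have hNm := hmN m hm
    have h8 : x m ≤ x s := sub_le_sub_of_steps hms.le fun j h _ => hxN j (by omega)
    have hm1 := (hψ.1 t (by omega) m hm).1
    have h9 : n m < n s := (sub_le_sub_of_steps (b := s - 1) (by omega) fun j h _ =>
      (hinc j (by omega)).le).trans_lt (by
        have := hinc (s - 1) (by omega)
        rwa [Nat.sub_add_cancel (by omega)] at this)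
    have h10 : n (s + 1) ≤ n t :=
      sub_le_sub_of_steps hst fun j h _ => (hinc j (by omega)).le
    have hss : n s - n (s - 1) ≤ n (s + 1) - n s := by
      obtain ⟨m', hm'⟩ := hinl s hs
      have h11 := hn s hs m' hm'
      have hm2 := hψ.1 s (by omega) m' hm'
      have : n m' ≤ n (s - 1) :=
        sub_le_sub_of_steps (by omega) fun j h _ => (hinc j (by omega)).le
      linarith
    have htt : n t - n (t - 1) ≤ n (t + 1) - n t := by
      have : n m ≤ n (t - 1) :=
        sub_le_sub_of_steps (by omega) fun j h _ => (hinc j (by omega)).le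
      linarith
    have hK0 := hn0 (K - 1)
    have hm0 := hn0 m
    -- With `D = n t - n s`, `h1`, `hss` and `h10` give `n t ≤ 3 * D + n (K - 1)`, and `n (K - 1) ≤
    -- n t / 6`.
    have h12 : n (t + 1) - n t ≤ 4 * (n t - n s) := by linarith
    have h13 : 5 / 4 * n t ≤ n (t + 1) := by linarith
    set k : ℝ := ((t - s : ℕ) : ℝ)
    set c := n (t + 1) - n t
    set c' := n t - n (t - 1)
    have hc0 : 0 < c := by simp only [c]; linarith
    have hc0' : 0 < c' := by simp only [c']; linarith
    have h14 : (x t - x (t - 1)) / c' ≤ 4 * ((x (t + 1) - x t) / c) := by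
      rw [← mul_div_assoc, div_le_div_iff₀ hc0' hc0]
      have h15 : k * (x t - x (t - 1)) ≤ x (t + 1) - x t := by linarith
      have h16 : c ≤ 4 * (k * c') := by linarith
      calc (x t - x (t - 1)) * c ≤ (x t - x (t - 1)) * (4 * (k * c')) :=
            mul_le_mul_of_nonneg_left h16 (by linarith)
        _ = 4 * (k * (x t - x (t - 1))) * c' := by ring
        _ ≤ 4 * (x (t + 1) - x t) * c' := by gcongr
    have h17 : 4 * n t ^ 7 ≤ n (t + 1) ^ 7 := by
      calc 4 * n t ^ 7 ≤ (5 / 4) ^ 7 * n t ^ 7 := by gcongr; norm_num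
        _ = (5 / 4 * n t) ^ 7 := by ring
        _ ≤ n (t + 1) ^ 7 := by gcongr
    calc (x t - x (t - 1)) / c' * n t ^ 7 ≤ 4 * ((x (t + 1) - x t) / c) * n t ^ 7 := by gcongr
      _ = (x (t + 1) - x t) / c * (4 * n t ^ 7) := by ring
      _ ≤ (x (t + 1) - x t) / c * n (t + 1) ^ 7 :=
        mul_le_mul_of_nonneg_left h17 (div_nonneg (by linarith) hc0.le)
  · rw [hn.step_eq hψ.1 (by omega) hKt.le hb, hx.step_eq hψ.1 (by omega) hKt.le hb]
    refine mul_le_mul_of_nonneg_left ?_ (div_nonneg (by linarith) (by linarith))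
    gcongr

/-- A Harnack inequality for the solutions with nonnegative increments. -/
theorem harnack (hψ : IsReduced ψ) (hK : IsBreak ψ K)
    (hinl : ∀ i, K ≤ i → ∃ m, ψ i = Sum.inl m) {n : ℕ → ℝ} (hn : Follows ψ K n)
    (hinc : ∀ i, 1 ≤ i → n i < n (i + 1)) (hn0 : ∀ i, 0 ≤ n i) {ε : ℝ} (hε : 0 < ε)
    (hwin : ∀ i, K ≤ i → ∀ m, ψ i = Sum.inl m → ε * n i ≤ n m) {x : ℕ → ℝ} (hx : Follows ψ K x)
    {N i₀ : ℕ} (hxN : ∀ j, N ≤ j → x j ≤ x (j + 1)) (hKi : K < i₀) (hNi : N ≤ i₀)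
    (hmN : ∀ i, i₀ ≤ i → ∀ m, ψ i = Sum.inl m → N ≤ m) (hlarge : 6 * n (K - 1) ≤ n i₀) (j : ℕ) :
    i₀ ≤ j → (ε / 2) ^ 7 * ((x (i₀ + 1) - x i₀) / (n (i₀ + 1) - n i₀)) * (n (j + 1) - n j) ≤
      x (j + 1) - x j := by
  have hmono : ∀ a b, 1 ≤ a → a ≤ b → n a ≤ n b := fun a b ha hab =>
    sub_le_sub_of_steps hab fun j h _ => (hinc j (by omega)).le
  have hpow : ∀ j, i₀ ≤ j → (x (i₀ + 1) - x i₀) / (n (i₀ + 1) - n i₀) * n (i₀ + 1) ^ 7 ≤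
      (x (j + 1) - x j) / (n (j + 1) - n j) * n (j + 1) ^ 7 := by
    intro j hj
    induction j, hj using Nat.le_induction with
    | base => exact le_rfl
    | succ j hj ih =>
      have h := harnack_step hψ hK hinl hn hinc hn0 hx hxN (t := j + 1) (by omega) (by omega)
        (hmN (j + 1) (by omega)) (hlarge.trans (hmono _ _ (by omega) (by omega)))
      exact ih.trans h
  have hE : 0 ≤ (x (i₀ + 1) - x i₀) / (n (i₀ + 1) - n i₀) :=
    div_nonneg (by linarith [hxN i₀ hNi]) (by linarith [hinc i₀ (by omega)])
  set E := (x (i₀ + 1) - x i₀) / (n (i₀ + 1) - n i₀)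
  induction j using Nat.strong_induction_on with
  | _ j ih =>
    intro hj
    obtain ⟨m, hm⟩ := hinl j (by omega)
    have hmj := hψ.1 j (by omega) m hm
    -- A window reaching below `i₀` forces `ε / 2 * n (j + 1) ≤ n (i₀ + 1)`, so the power bound
    -- `hpow` costs only `(ε / 2) ^ 7`. Otherwise the bound is inherited by summing over the window.
    by_cases hmi : m < i₀
    · have h1 := hwin j (by omega) m hm
      have h2 : n m ≤ n (i₀ + 1) := hmono _ _ hmj.1 (by omega)
      have h3 := hn j (by omega) m hm
      have h4 := hpow j hj
      have hc := hinc j (by omega)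
      have hm0 := hn0 m
      have hj0 := hn0 j
      have h5 : ε / 2 * n (j + 1) ≤ n (i₀ + 1) := by nlinarith
      have h6 : (ε / 2) ^ 7 * n (j + 1) ^ 7 ≤ n (i₀ + 1) ^ 7 := by
        rw [← mul_pow]
        have := hn0 (j + 1)
        gcongr
      have hp : 0 < n (j + 1) ^ 7 := by
        have : 0 < n (j + 1) := by linarith
        positivity
      have h7 : (ε / 2) ^ 7 * E ≤ (x (j + 1) - x j) / (n (j + 1) - n j) := by
        refine le_of_mul_le_mul_right ?_ hp
        calc (ε / 2) ^ 7 * E * n (j + 1) ^ 7 = E * ((ε / 2) ^ 7 * n (j + 1) ^ 7) := by ring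
          _ ≤ E * n (i₀ + 1) ^ 7 := mul_le_mul_of_nonneg_left h6 hE
          _ ≤ _ := h4
      rwa [le_div_iff₀ (by linarith)] at h7
    · have h1 := hn j (by omega) m hm
      have h2 := hx j (by omega) m hm
      have h3 := sub_le_sub_of_steps (x := fun j => x j - (ε / 2) ^ 7 * E * n j) hmj.2.le
        fun l h4 h5 => by
          have := ih l h5 (by omega)
          linarith
      rw [h1, h2]
      linarith

end Harnack

/-! ### Convergence of the quotients -/

section Convergence

variable {A : Type u} {ψ : ℕ → ℕ ⊕ A} {K : ℕ}

/-- Finitely many indices below `K` fix `C`; afterwards each increment is a sum of earlier ones. -/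
theorem exists_increment_le (hψ : IsReduced ψ) (hinl : ∀ i, K ≤ i → ∃ m, ψ i = Sum.inl m)
    {n x : ℕ → ℝ} (hn : Follows ψ K n) (hx : Follows ψ K x)
    (hinc : ∀ i, 1 ≤ i → n i < n (i + 1)) :
    ∃ C : ℝ, 0 < C ∧ ∀ j, 1 ≤ j → x (j + 1) - x j ≤ C * (n (j + 1) - n j) := by
  have hfin : ∀ k, ∃ C : ℝ, 0 < C ∧ ∀ j, 1 ≤ j → j < k →
      x (j + 1) - x j ≤ C * (n (j + 1) - n j) := by
    intro k
    induction k with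
    | zero => exact ⟨1, one_pos, fun j _ h => by omega⟩
    | succ k ih =>
      obtain ⟨C, hC, h⟩ := ih
      refine ⟨max C ((x (k + 1) - x k) / (n (k + 1) - n k)), lt_max_of_lt_left hC, ?_⟩
      intro j hj hjk
      have hc := sub_pos.2 (hinc j hj)
      rcases (Nat.lt_succ_iff.1 hjk).eq_or_lt with rfl | hlt
      · rw [← div_le_iff₀ hc]
        exact le_max_right _ _
      · exact (h j hj hlt).trans (mul_le_mul_of_nonneg_right (le_max_left _ _) hc.le)
  obtain ⟨C, hC, h⟩ := hfin K
  refine ⟨C, hC, fun j => ?_⟩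
  induction j using Nat.strong_induction_on with
  | _ j ih =>
    intro hj
    by_cases hjK : j < K
    · exact h j hj hjK
    · obtain ⟨m, hm⟩ := hinl j (by omega)
      have hmj := hψ.1 j hj m hm
      have h3 := sub_le_sub_of_steps (x := fun j => C * n j - x j) hmj.2.le
        fun l h4 h5 => by
          have := ih l h5 (by omega)
          linarith
      rw [hn j (by omega) m hm, hx j (by omega) m hm]
      linarith

/-- Were liminf `m` and limsup `M` of the quotients distinct, Harnack applied to `(M + η) * n - x`
or to `x - (m - η) * n` would push all later quotients away from `M` or from `m`. -/
theorem exists_tendsto_increment (hψ : IsReduced ψ) (hK : IsBreak ψ K)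
    (hinl : ∀ i, K ≤ i → ∃ m, ψ i = Sum.inl m) {n : ℕ → ℝ} (hn : Follows ψ K n)
    (hinc : ∀ i, 1 ≤ i → n i < n (i + 1)) (hn0 : ∀ i, 0 ≤ n i) (htop : Tendsto n atTop atTop)
    {ε : ℝ} (hε : 0 < ε) (hwin : ∀ i, K ≤ i → ∀ m, ψ i = Sum.inl m → ε * n i ≤ n m)
    {x : ℕ → ℝ} (hx : Follows ψ K x) (hxinc : ∀ i, 1 ≤ i → x i < x (i + 1)) :
    ∃ R : ℝ, 0 < R ∧
      Tendsto (fun j => (x (j + 1) - x j) / (n (j + 1) - n j)) atTop (nhds R) := by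
  set r : ℕ → ℝ := fun j => (x (j + 1) - x j) / (n (j + 1) - n j) with hr
  have hrmul : ∀ j, 1 ≤ j → r j * (n (j + 1) - n j) = x (j + 1) - x j := fun j hj =>
    div_mul_cancel₀ _ (sub_pos.2 (hinc j hj)).ne'
  obtain ⟨C, hC, hxC⟩ := exists_increment_le hψ hinl hn hx hinc
  obtain ⟨c, hc, hcx⟩ := exists_increment_le hψ hinl hx hn hxinc
  have hup : ∀ᶠ j in atTop, r j ≤ C := by
    filter_upwards [eventually_ge_atTop 1] with j hj
    exact (div_le_iff₀ (sub_pos.2 (hinc j hj))).2 (hxC j hj)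
  have hlow : ∀ᶠ j in atTop, c⁻¹ ≤ r j := by
    filter_upwards [eventually_ge_atTop 1] with j hj
    rw [hr, le_div_iff₀ (sub_pos.2 (hinc j hj)), inv_mul_le_iff₀ hc]
    exact hcx j hj
  have hbu : IsBoundedUnder (· ≤ ·) atTop r := ⟨C, eventually_map.2 hup⟩
  have hbl : IsBoundedUnder (· ≥ ·) atTop r := ⟨c⁻¹, eventually_map.2 hlow⟩
  have hcu : IsCoboundedUnder (· ≤ ·) atTop r := hbl.isCoboundedUnder_le
  have hcl : IsCoboundedUnder (· ≥ ·) atTop r := hbu.isCoboundedUnder_ge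
  set M := limsup r atTop with hM
  set m := liminf r atTop with hm
  have hmM : m ≤ M := liminf_le_limsup hbu hbl
  have hm0 : c⁻¹ ≤ m := le_liminf_of_le hcl hlow
  -- As `n m ≥ ε * n i` and `n` tends to infinity, windows eventually start beyond any `N`.
  have hwindow : ∀ N, ∀ᶠ i₀ in atTop, K < i₀ ∧ N ≤ i₀ ∧ 1 ≤ i₀ ∧
      (∀ i, i₀ ≤ i → ∀ m, ψ i = Sum.inl m → N ≤ m) ∧ 6 * n (K - 1) ≤ n i₀ := by
    intro N
    have hev : ∀ᶠ i₀ in atTop, ∀ i, i₀ ≤ i → n N / ε + 1 ≤ n i := by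
      obtain ⟨a, ha⟩ := eventually_atTop.1 (htop.eventually_ge_atTop (n N / ε + 1))
      filter_upwards [eventually_ge_atTop a] with i₀ h i hi using ha i (h.trans hi)
    filter_upwards [hev, eventually_gt_atTop K, eventually_ge_atTop N, eventually_ge_atTop 1,
      htop.eventually_ge_atTop (6 * n (K - 1))] with i₀ h1 h2 h3 h4 h5
    refine ⟨h2, h3, h4, fun i hi k hk => ?_, h5⟩
    by_contra hlt
    have h6 := hwin i (by omega) k hk
    have hk1 := (hψ.1 i (by omega) k hk).1
    have h7 : n k ≤ n N :=
      sub_le_sub_of_steps (by omega) fun j h _ => (hinc j (by omega)).le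
    have h8 := h1 i hi
    have h9 : ε * (n N / ε + 1) ≤ ε * n i := by gcongr
    rw [mul_add, mul_div_cancel₀ _ hε.ne'] at h9
    linarith
  have hEq : m = M := by
    by_contra hne
    have hlt : m < M := lt_of_le_of_ne hmM hne
    set θ := (ε / 2) ^ 7 with hθ
    have hθ0 : 0 < θ := by positivity
    -- The Harnack gain `θ * (M - m) / 2 = 2 * η` beats the tolerance `η`, leaving a margin `η`.
    set η := θ * (M - m) / 4 with hη
    have hη0 : 0 < η := by have := sub_pos.2 hlt; positivity
    have h1 : ∀ᶠ j in atTop, r j < M + η := eventually_lt_of_limsup_lt (by linarith) hbu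
    have h2 : ∀ᶠ j in atTop, m - η < r j := eventually_lt_of_lt_liminf (by linarith) hbl
    obtain ⟨N, hN⟩ := eventually_atTop.1 ((h1.and h2).and (eventually_ge_atTop 1))
    obtain ⟨i₀, hKi, hNi, hi1, hmN, hlarge⟩ := (hwindow N).exists
    have hci : n (i₀ + 1) - n i₀ ≠ 0 := (sub_pos.2 (hinc i₀ hi1)).ne'
    rcases le_total (r i₀) ((M + m) / 2) with hle | hle
    · have hy := hn.sub_mul hx (M + η) 1
      have hH := harnack hψ hK hinl hn hinc hn0 hε hwin hy (N := N) (fun j hj => by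
        have := hrmul j (hN j hj).2
        nlinarith [(hN j hj).1.1, sub_pos.2 (hinc j (hN j hj).2)]) hKi hNi hmN hlarge
      have hfinal : ∀ᶠ j in atTop, r j ≤ M - η := by
        filter_upwards [eventually_ge_atTop i₀] with j hj
        have h3 := hH j hj
        have e : ((M + η) * n (i₀ + 1) - 1 * x (i₀ + 1) - ((M + η) * n i₀ - 1 * x i₀)) /
            (n (i₀ + 1) - n i₀) = M + η - r i₀ := by
          rw [hr]
          field_simp
          ring
        rw [e, ← hθ] at h3
        have h4 := hrmul j (by omega)
        have h5 := sub_pos.2 (hinc j (by omega))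
        have h6 : θ * (M + η - r i₀) ≤ M + η - r j := by
          refine le_of_mul_le_mul_right ?_ h5
          linarith
        have h7 : θ * ((M - m) / 2) ≤ θ * (M + η - r i₀) := by
          refine mul_le_mul_of_nonneg_left ?_ hθ0.le
          linarith
        linarith
      have := limsup_le_of_le hcu hfinal
      linarith
    · have hy := hx.sub_mul hn 1 (m - η)
      have hH := harnack hψ hK hinl hn hinc hn0 hε hwin hy (N := N) (fun j hj => by
        have := hrmul j (hN j hj).2
        nlinarith [(hN j hj).1.2, sub_pos.2 (hinc j (hN j hj).2)]) hKi hNi hmN hlarge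
      have hfinal : ∀ᶠ j in atTop, m + η ≤ r j := by
        filter_upwards [eventually_ge_atTop i₀] with j hj
        have h3 := hH j hj
        have e : (1 * x (i₀ + 1) - (m - η) * n (i₀ + 1) - (1 * x i₀ - (m - η) * n i₀)) /
            (n (i₀ + 1) - n i₀) = r i₀ - (m - η) := by
          rw [hr]
          field_simp
          ring
        rw [e, ← hθ] at h3
        have h4 := hrmul j (by omega)
        have h5 := sub_pos.2 (hinc j (by omega))
        have h6 : θ * (r i₀ - (m - η)) ≤ r j - (m - η) := by
          refine le_of_mul_le_mul_right ?_ h5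
          linarith
        have h7 : θ * ((M - m) / 2) ≤ θ * (r i₀ - (m - η)) := by
          refine mul_le_mul_of_nonneg_left ?_ hθ0.le
          linarith
        linarith
      have := le_liminf_of_le hcl hfinal
      linarith
  exact ⟨M, by have := inv_pos.2 hc; linarith, tendsto_of_liminf_eq_limsup (by rw [← hm, hEq]) rfl
    hbu hbl⟩

/-- Stolz–Cesàro: the increments of `x - R * n` are negligible against those of `n`, and this
survives summation. -/
theorem tendsto_div_of_increments {n x : ℕ → ℝ} {R : ℝ} (hinc : ∀ i, 1 ≤ i → n i < n (i + 1))
    (htop : Tendsto n atTop atTop)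
    (h : Tendsto (fun j => (x (j + 1) - x j) / (n (j + 1) - n j)) atTop (nhds R)) :
    Tendsto (fun j => x j / n j) atTop (nhds R) := by
  have h1 : (fun j => (x (j + 1 + 1) - x (j + 1)) - R * (n (j + 1 + 1) - n (j + 1)))
      =o[atTop] fun j => n (j + 1 + 1) - n (j + 1) := by
    rw [Asymptotics.isLittleO_iff_tendsto' (by
      filter_upwards with j hj
      exact absurd hj (sub_pos.2 (hinc (j + 1) (by omega))).ne')]
    have h2 := ((tendsto_add_atTop_iff_nat 1).2 h).sub_const R
    rw [sub_self] at h2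
    refine h2.congr fun j => ?_
    have := (sub_pos.2 (hinc (j + 1) (by omega))).ne'
    field_simp
  have htop' : Tendsto (fun j => n (j + 1)) atTop atTop := (tendsto_add_atTop_iff_nat 1).2 htop
  have hsum : ∀ (y : ℕ → ℝ) (k : ℕ),
      ∑ j ∈ Finset.range k, (y (j + 1 + 1) - y (j + 1)) = y (k + 1) - y (0 + 1) := fun y k =>
    Finset.sum_range_sub (fun j => y (j + 1)) k
  have h3 := h1.sum_range (fun j => (sub_pos.2 (hinc (j + 1) (by omega))).le) (by
    simp_rw [hsum]
    exact tendsto_atTop_add_const_right _ _ htop')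
  simp_rw [Finset.sum_sub_distrib (fun j => x (j + 1 + 1) - x (j + 1)), ← Finset.mul_sum,
    hsum] at h3
  have h4 : (fun _ : ℕ => n (0 + 1)) =o[atTop] fun j => n (j + 1) :=
    Asymptotics.isLittleO_const_left.2 (Or.inr (tendsto_norm_atTop_atTop.comp htop'))
  have h5 : (fun _ : ℕ => x (0 + 1) - R * n (0 + 1)) =o[atTop] fun j => n (j + 1) :=
    Asymptotics.isLittleO_const_left.2 (Or.inr (tendsto_norm_atTop_atTop.comp htop'))
  have h6 := (h3.trans_isBigO ((Asymptotics.isBigO_refl _ _).sub h4.isBigO)).add h5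
  have h7 := h6.tendsto_div_nhds_zero.add_const R
  rw [zero_add R] at h7
  refine (tendsto_add_atTop_iff_nat 1).1 (h7.congr' ?_)
  filter_upwards [htop'.eventually_gt_atTop 0] with j hj
  field_simp
  ring

end Convergence

/-! ### Computing and comparing limsups of ratios -/

section Limsup

/-- The ratios of `m` are those of `n` times a factor `v` tending to 1, and the limsup is
submultiplicative. -/
theorem ratioLimsup_le_of_tendsto {n m : ℕ → ℕ} {R : ℝ} (hR : 0 < R)
    (hn : ∀ᶠ i in atTop, 0 < n i) (hm : ∀ᶠ i in atTop, 0 < m i)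
    (h : Tendsto (fun i => (m i : ℝ) / (n i : ℝ)) atTop (nhds R)) :
    ratioLimsup m ≤ ratioLimsup n := by
  set v : ℕ → ℝ≥0∞ := fun i =>
    ENNReal.ofReal (((m (i + 1) : ℝ) / (n (i + 1) : ℝ)) / ((m i : ℝ) / (n i : ℝ)))
  have hv : Tendsto v atTop (nhds 1) := by
    have h1 := ((tendsto_add_atTop_iff_nat 1).2 h).div h hR.ne'
    rw [div_self hR.ne'] at h1
    simpa using ENNReal.tendsto_ofReal h1
  have hls : limsup v atTop = 1 := hv.limsup_eq
  have hmul : ratioLimsup m =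
      limsup (v * fun i : ℕ => (n (i + 1) : ℝ≥0∞) / (n i : ℝ≥0∞)) atTop := by
    refine limsup_congr ?_
    have hn' := (tendsto_add_atTop_nat 1).eventually hn
    filter_upwards [hn, hm, hn'] with i h1 h2 h3
    have h1' : (0 : ℝ) < n i := by exact_mod_cast h1
    have h2' : (0 : ℝ) < m i := by exact_mod_cast h2
    have h3' : (0 : ℝ) < n (i + 1) := by exact_mod_cast h3
    have key : ∀ a b : ℕ, 0 < b → (a : ℝ≥0∞) / (b : ℝ≥0∞) = ENNReal.ofReal ((a : ℝ) / b) := by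
      intro a b hb
      rw [ENNReal.ofReal_div_of_pos (by exact_mod_cast hb), ENNReal.ofReal_natCast,
        ENNReal.ofReal_natCast]
    rw [Pi.mul_apply, key _ _ h1, key _ _ h2, ← ENNReal.ofReal_mul (by positivity)]
    congr 1
    field_simp
  rw [hmul]
  refine (ENNReal.limsup_mul_le' ?_ ?_).trans ?_
  · left; rw [hls]; exact one_ne_zero
  · left; rw [hls]; exact ENNReal.one_ne_top
  · rw [hls, one_mul]
    exact le_rfl

theorem ratioLimsup_eq_of_tendsto {n m : ℕ → ℕ} {R : ℝ} (hR : 0 < R)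
    (hn : ∀ᶠ i in atTop, 0 < n i) (hm : ∀ᶠ i in atTop, 0 < m i)
    (h : Tendsto (fun i => (m i : ℝ) / (n i : ℝ)) atTop (nhds R)) :
    ratioLimsup m = ratioLimsup n := by
  refine le_antisymm (ratioLimsup_le_of_tendsto hR hn hm h) ?_
  refine ratioLimsup_le_of_tendsto (inv_pos.2 hR) hm hn ?_
  refine (h.inv₀ hR.ne').congr fun i => ?_
  rw [inv_div]

theorem tendsto_affine_ratio {n : ℕ → ℕ} (htop : Tendsto n atTop atTop) (a c : ℕ) :
    Tendsto (fun i => ((a * n i + c : ℕ) : ℝ≥0∞) / (n i : ℝ≥0∞)) atTop (nhds a) := by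
  have h1 : Tendsto (fun i => (a : ℝ≥0∞) + c * (n i : ℝ≥0∞)⁻¹) atTop (nhds (a + c * 0)) :=
    tendsto_const_nhds.add (ENNReal.Tendsto.const_mul
      (ENNReal.tendsto_inv_nat_nhds_zero.comp htop) (Or.inr (ENNReal.natCast_ne_top c)))
  rw [mul_zero, add_zero] at h1
  refine h1.congr' ?_
  filter_upwards [htop.eventually_gt_atTop 0] with i hi
  rw [Nat.cast_add, Nat.cast_mul, ENNReal.add_div, ENNReal.mul_div_cancel_right
    (by exact_mod_cast hi.ne') (ENNReal.natCast_ne_top _), div_eq_mul_inv (c : ℝ≥0∞)]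

theorem ratioLimsup_of_affine {n : ℕ → ℕ} (htop : Tendsto n atTop atTop) {a c : ℕ}
    (h : ∀ᶠ i in atTop, n (i + 1) = a * n i + c) : ratioLimsup n = a := by
  rw [← (tendsto_affine_ratio htop a c).limsup_eq]
  refine limsup_congr ?_
  filter_upwards [h] with i hi
  rw [hi]

theorem ratioLimsup_le_two {n : ℕ → ℕ} (htop : Tendsto n atTop atTop)
    (h : ∀ᶠ i in atTop, n (i + 1) ≤ 2 * n i + 1) : ratioLimsup n ≤ 2 := by
  have h2 := (tendsto_affine_ratio htop 2 1).limsup_eq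
  rw [Nat.cast_ofNat] at h2
  rw [← h2]
  refine limsup_le_limsup ?_
  filter_upwards [h] with i hi
  gcongr

theorem one_le_ratioLimsup {n : ℕ → ℕ} (h0 : ∀ᶠ i in atTop, 0 < n i)
    (h : ∀ᶠ i in atTop, n i ≤ n (i + 1)) : 1 ≤ ratioLimsup n := by
  refine le_limsup_of_frequently_le (Eventually.frequently ?_)
  filter_upwards [h0, h] with i h1 h2
  rw [ENNReal.le_div_iff_mul_le (Or.inl (by exact_mod_cast h1.ne'))
    (Or.inl (ENNReal.natCast_ne_top _)), one_mul]
  exact_mod_cast h2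

end Limsup

/-! ### Values attained, and words with δ < 2 -/

section Values

variable {A : Type u}

theorem tendsto_atTop_of_lt_succ {n : ℕ → ℕ} (h : ∀ i, 1 ≤ i → n i < n (i + 1)) :
    Tendsto n atTop atTop :=
  (tendsto_add_atTop_iff_nat 1).1 (tendsto_atTop_mono (le_of_lt_succ h) tendsto_id)

theorem reducedValues_subset_Icc : reducedValues.{u} ⊆ Set.Icc 1 2 := by
  rintro x ⟨A, ψ, hψ, rfl⟩
  have htop := tendsto_atTop_of_lt_succ (recSeq_lt_succ hψ.1)
  refine ⟨one_le_ratioLimsup (htop.eventually_gt_atTop 0) ?_, ratioLimsup_le_two htop ?_⟩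
  · filter_upwards [eventually_ge_atTop 1] with i hi using (recSeq_lt_succ hψ.1 i hi).le
  · filter_upwards [eventually_ge_atTop 1] with i hi using recSeq_succ_le hψ.1 hi

/-- Realised by the constant word, for which `n i = i - 1`. -/
theorem one_mem_reducedValues : (1 : ℝ≥0∞) ∈ reducedValues.{u} := by
  let ψ : ℕ → ℕ ⊕ PUnit.{u + 1} := fun i => if i = 1 then Sum.inr ⟨⟩ else Sum.inl (i - 1)
  have h1 : ψ 1 = Sum.inr ⟨⟩ := if_pos rfl
  have h2 : ∀ i, 2 ≤ i → ψ i = Sum.inl (i - 1) := fun i hi => if_neg (by omega)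
  have hdir : IsDirective ψ := by
    intro i hi m hm
    rcases hi.eq_or_lt with rfl | hi
    · simp [h1] at hm
    · rw [h2 i hi] at hm
      have := Sum.inl_injective hm
      omega
  have hbreak : ∀ i, IsBreak ψ i → i = 1 := by
    rintro i ⟨hi, h⟩
    by_contra hne
    rw [h2 i (by omega)] at h
    rcases h with ⟨a, ha⟩ | ⟨m, hm, -, h⟩
    · simp at ha
    · have := Sum.inl_injective hm
      omega
  refine ⟨_, ψ, ⟨hdir, fun s t hst => ?_⟩, ?_⟩
  · have := hbreak s hst.1
    have := hbreak t hst.2.1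
    have := hst.2.2.1
    omega
  · have hrec : ∀ i, recSeq ψ (i + 1) = i := by
      intro i
      induction i using Nat.strong_induction_on with
      | _ i ih =>
        rcases i with _ | _ | i
        · exact recSeq_one ψ
        · rw [recSeq_succ_of_inr ψ le_rfl h1, recSeq_one]
        · rw [recSeq_succ_of_inl ψ hdir (by omega) (h2 _ (by omega)), ih (i + 1) (by omega),
            show i + 1 + 1 - 1 = i + 1 by omega, ih i (by omega)]
          omega
    have := ratioLimsup_of_affine (a := 1) (c := 1)
      (tendsto_atTop_of_lt_succ (recSeq_lt_succ hdir)) (by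
        filter_upwards [eventually_ge_atTop 1] with i hi
        obtain ⟨j, rfl⟩ : ∃ j, i = j + 1 := ⟨i - 1, by omega⟩
        rw [hrec, hrec]
        omega)
    rw [deltaFun, this, Nat.cast_one]

/-- Pairwise distinct letters. This value needs its own witness because the window bound degenerates
at δ = 2. -/
theorem two_mem_reducedValues : (2 : ℝ≥0∞) ∈ reducedValues.{u} := by
  let ψ : ℕ → ℕ ⊕ ULift.{u} ℕ := fun i => Sum.inr ⟨i⟩
  have hdir : IsDirective ψ := fun i _ m hm => by simp [ψ] at hm
  refine ⟨_, ψ, ⟨hdir, fun s t hst => ⟨?_, Or.inl ⟨_, rfl⟩⟩⟩, ?_⟩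
  · have := hst.2.2.1
    simp only [ψ, ne_eq, Sum.inr.injEq, ULift.up.injEq]
    omega
  · have := ratioLimsup_of_affine (a := 2) (c := 1)
      (tendsto_atTop_of_lt_succ (recSeq_lt_succ hdir)) (by
        filter_upwards [eventually_ge_atTop 1] with i hi
        exact recSeq_succ_of_inr ψ hi rfl)
    rw [deltaFun, this, Nat.cast_ofNat]

/-- The function with pairwise distinct letters below `K`, and given by `f` from `K` on. -/
def spliced (f : ℕ → ℕ) (K i : ℕ) : ℕ ⊕ ULift.{u} ℕ :=
  if i < K then Sum.inr ⟨i⟩ else Sum.inl (f i)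

theorem spliced_of_lt {f : ℕ → ℕ} {K i : ℕ} (h : i < K) :
    spliced.{u} f K i = Sum.inr ⟨i⟩ := if_pos h

theorem spliced_of_le {f : ℕ → ℕ} {K i : ℕ} (h : K ≤ i) :
    spliced.{u} f K i = Sum.inl (f i) := if_neg (by omega)

theorem isBreak_iff_of_inl {ψ : ℕ → ℕ ⊕ A} {i m : ℕ} (h : ψ i = Sum.inl m) (hm : 1 ≤ m) :
    IsBreak ψ i ↔ m + 2 ≤ i := by
  constructor
  · rintro ⟨-, ⟨a, ha⟩ | ⟨m', h1, -, h2⟩⟩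
    · simp [h] at ha
    · rw [h] at h1
      rwa [Sum.inl_injective h1]
  · intro hi
    exact ⟨by omega, Or.inr ⟨m, h, hm, hi⟩⟩

variable {w : ℕ → A} {n : ℕ → ℕ}

/-- Splicing at a break makes `K - 1`, `K` the only consecutive breaks astride the splice; there a
letter meets an integer, and `f K < K - 1` is exactly `hK`. Later pairs are inherited from the word.
-/
theorem IsPalEnum.isReduced_spliced (h : IsPalEnum w n) {f : ℕ → ℕ} {K : ℕ}
    (hf : ∀ i, K ≤ i → 1 ≤ f i ∧ f i < i ∧ n (i + 1) + n (f i) = 2 * n i) (hK : f K + 2 ≤ K) :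
    IsReduced (spliced.{u} f K) := by
  have hbreak : ∀ i, K ≤ i → (IsBreak (spliced.{u} f K) i ↔ f i + 2 ≤ i) := fun i hi =>
    isBreak_iff_of_inl (spliced_of_le hi) (hf i hi).1
  have hbreak' : ∀ i, K ≤ i → (IsBreak (fun i => (Sum.inl (f i) : ℕ ⊕ A)) i ↔ f i + 2 ≤ i) :=
    fun i hi => isBreak_iff_of_inl rfl (hf i hi).1
  refine ⟨fun i _ m hm => ?_, fun s t hst => ?_⟩
  · by_cases hiK : i < K
    · simp [spliced_of_lt hiK] at hm
    · rw [spliced_of_le (not_lt.1 hiK)] at hm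
      rw [← Sum.inl_injective hm]
      exact ⟨(hf i (not_lt.1 hiK)).1, (hf i (not_lt.1 hiK)).2.1⟩
  · obtain ⟨h1, h2, hlt, hno⟩ := id hst
    by_cases htK : t < K
    · rw [spliced_of_lt htK, spliced_of_lt (hlt.trans htK)]
      refine ⟨fun hc => ?_, Or.inl ⟨_, rfl⟩⟩
      have := congrArg ULift.down (Sum.inr_injective hc)
      simp only at this
      omega
    by_cases hsK : s < K
    · have ht : t = K := by
        by_contra hne
        exact hno K hsK (by omega) ((hbreak K le_rfl).2 hK)
      subst ht
      have hs : s = t - 1 := by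
        by_contra hne
        exact hno (t - 1) (by omega) (by omega)
          ⟨by omega, Or.inl ⟨_, spliced_of_lt (by omega)⟩⟩
      rw [spliced_of_le le_rfl, spliced_of_lt hsK]
      exact ⟨Sum.inl_ne_inr, Or.inr ⟨_, rfl, by omega⟩⟩
    · have hst' : ConsecutiveBreaks (fun i => (Sum.inl (f i) : ℕ ⊕ A)) s t :=
        ⟨(hbreak' s (by omega)).2 ((hbreak s (by omega)).1 h1),
          (hbreak' t (by omega)).2 ((hbreak t (by omega)).1 h2), hlt, fun r hr1 hr2 hr =>
          hno r hr1 hr2 ((hbreak r (by omega)).2 ((hbreak' r (by omega)).1 hr))⟩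
      obtain ⟨h3, h4⟩ := h.reduced_of_describes (fun r hr1 _ => by
        obtain ⟨e1, e2, e3⟩ := hf r (by omega)
        exact Or.inr ⟨f r, e1, e2, e3, rfl⟩) hst'
      rw [spliced_of_le (not_lt.1 htK), spliced_of_le (not_lt.1 hsK)]
      refine ⟨fun hc => h3 (congrArg Sum.inl (Sum.inl_injective hc)), Or.inr ⟨f t, rfl, ?_⟩⟩
      rcases h4 with ⟨a, ha⟩ | ⟨m, hm, hms⟩
      · simp at ha
      · rwa [Sum.inl_injective hm]

theorem IsPalEnum.ratioLimsup_mem (h : IsPalEnum w n) (hlt : ratioLimsup n < 2) :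
    ratioLimsup n ∈ reducedValues.{u} := by
  have htop := tendsto_atTop_of_lt_succ h.lt_succ
  obtain ⟨q, hq, hq2⟩ := ENNReal.lt_iff_exists_nnreal_btwn.1 hlt
  have hq2' : (q : ℝ) < 2 := by exact_mod_cast hq2
  obtain ⟨I, hI⟩ := eventually_atTop.1 (((eventually_lt_of_limsup_lt hq).and
    (htop.eventually_gt_atTop 0)).and (eventually_ge_atTop 1))
  have hratio : ∀ i, I ≤ i → (n (i + 1) : ℝ) ≤ q * n i := by
    intro i hi
    have h1 := (hI i hi).1.1.le
    rw [ENNReal.div_le_iff_le_mul (Or.inl (by exact_mod_cast (hI i hi).1.2.ne'))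
      (Or.inl (ENNReal.natCast_ne_top _))] at h1
    exact_mod_cast h1
  have hex : ∀ i, ∃ j, I ≤ i → 1 ≤ j ∧ j < i ∧ n (i + 1) + n j = 2 * n i := by
    intro i
    by_cases hi : I ≤ i
    · have h1 := hratio i hi
      have h2 : (n (i + 1) : ℝ) ≤ ((2 * n i : ℕ) : ℝ) := by
        push_cast
        exact h1.trans (by gcongr)
      obtain ⟨j, hj⟩ := h.exists_overlap (hI i hi).2 (by exact_mod_cast h2)
      exact ⟨j, fun _ => hj⟩
    · exact ⟨0, fun hc => absurd hc hi⟩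
  choose f hf using hex
  -- Without late breaks, `n` is eventually an arithmetic progression and the value is 1.
  by_cases hbr : ∃ K, I ≤ K ∧ f K + 2 ≤ K
  · obtain ⟨K, hIK, hK⟩ := hbr
    have hred := h.isReduced_spliced (fun i hi => hf i (hIK.trans hi)) hK
    have hKb : IsBreak (spliced.{u} f K) K :=
      (isBreak_iff_of_inl (spliced_of_le le_rfl) (hf K hIK).1).2 hK
    refine ⟨_, spliced.{u} f K, hred, ?_⟩
    have hinl : ∀ i, K ≤ i → ∃ m, spliced.{u} f K i = Sum.inl m := fun i hi =>
      ⟨_, spliced_of_le hi⟩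
    have heq : ∀ i, K ≤ i → ∀ m, spliced.{u} f K i = Sum.inl m →
        (n (i + 1) : ℝ) + n m = 2 * n i := by
      intro i hi m hm
      rw [spliced_of_le hi] at hm
      rw [← Sum.inl_injective hm]
      exact_mod_cast (hf i (hIK.trans hi)).2.2
    have hn : Follows (spliced.{u} f K) K fun i => (n i : ℝ) := fun i hi m hm =>
      eq_sub_of_add_eq (heq i hi m hm)
    have hx : Follows (spliced.{u} f K) K fun i => (recSeq (spliced.{u} f K) i : ℝ) := by
      intro i hi m hm
      have e := cast_recSeq_succ_of_inl _ hred.1 (hKb.1.trans hi) hm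
      have e' := congrArg (Int.cast : ℤ → ℝ) e
      push_cast at e'
      exact e'
    have hinc : ∀ i, 1 ≤ i → (n i : ℝ) < n (i + 1) := fun i hi => by
      exact_mod_cast h.lt_succ i hi
    have htop' : Tendsto (fun i => (n i : ℝ)) atTop atTop := tendsto_natCast_atTop_atTop.comp htop
    -- The window constant: `n m = 2 * n i - n (i + 1) ≥ (2 - q) * n i`.
    obtain ⟨R, hR, hlim⟩ := exists_tendsto_increment hred hKb hinl hn hinc
      (fun i => Nat.cast_nonneg _) htop' (ε := 2 - q) (by linarith) (fun i hi m hm => by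
        have h1 := heq i hi m hm
        have h2 := hratio i (hIK.trans hi)
        linarith) hx (fun i hi => by exact_mod_cast recSeq_lt_succ hred.1 i hi)
    exact ratioLimsup_eq_of_tendsto hR (htop.eventually_gt_atTop 0)
      ((tendsto_atTop_of_lt_succ (recSeq_lt_succ hred.1)).eventually_gt_atTop 0)
      (tendsto_div_of_increments hinc htop' hlim)
  · push Not at hbr
    have hconst : ∀ i, I ≤ i → n (i + 1) = n i + (n (I + 1) - n I) := fun i hi =>
      steps_eq (t := i + 1) (fun r h1 _ => by
        have h3 := hbr r h1.le
        obtain ⟨-, h4, h5⟩ := hf r h1.le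
        rwa [show r - 1 = f r by omega]) (h.lt_succ I (hI I le_rfl).2).le i hi (by omega)
    rw [ratioLimsup_of_affine htop (a := 1) (c := n (I + 1) - n I) (by
      filter_upwards [eventually_ge_atTop I] with i hi
      rw [hconst i hi, one_mul]), Nat.cast_one]
    exact one_mem_reducedValues

theorem setD_inter_Icc_subset_reducedValues :
    setD.{u} ∩ Set.Icc 1 2 ⊆ reducedValues.{u} := by
  rintro x ⟨⟨A, w, rfl⟩, -, h2⟩
  have hinf : InfinitelyManyPal w := by
    by_contra hc
    rw [deltaWord, if_neg hc] at h2
    exact absurd h2 (by simp)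
  have h := isPalEnum_palLength hinf
  rcases h2.eq_or_lt with he | hlt
  · rw [he]
    exact two_mem_reducedValues
  · rw [h.deltaWord_eq] at hlt ⊢
    exact h.ratioLimsup_mem hlt

end Values

theorem setD₀_subset_setD : setD₀.{u} ⊆ setD.{u} := fun _ ⟨A, w, _, h⟩ => ⟨A, w, h⟩

end PalPrefix

theorem theorem6p3 :
    PalPrefix.setD₀.{u} = PalPrefix.reducedValues.{u} ∧
      PalPrefix.setD.{u} ∩ Set.Icc (1 : ENNReal) 2 = PalPrefix.reducedValues.{u} := by
  refine ⟨Set.Subset.antisymm PalPrefix.setD₀_subset_reducedValues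
    PalPrefix.reducedValues_subset_setD₀, Set.Subset.antisymm
    PalPrefix.setD_inter_Icc_subset_reducedValues fun x hx => ?_⟩
  exact ⟨PalPrefix.setD₀_subset_setD (PalPrefix.reducedValues_subset_setD₀ hx),
    PalPrefix.reducedValues_subset_Icc hx⟩
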